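/- Let $E=\mathbb{R}$ or $E=\mathbb{C}$, let $d=[E:\mathbb{R}]$, and let $|\cdot|$ be the normalized absolute value on $E$ (the usual one on $\mathbb{R}$, its square on $\mathbb{C}$). Let $K$ be the standard maximal compact subgroup of $\mathrm{GL}_2(E)$ (that is, $\mathrm{O}(2)$ or $\mathrm{U}(2)$), let $\mathrm{GL}_2(E)^1=\{g\in \mathrm{GL}_2(E):|\det g|=1\}$, and fix Haar measures $dg$ on $\mathrm{GL}_2(E)$ and $dg^1$ on $\mathrm{GL}_2(E)^1$. Let $\psi(x)=e^{-2\pi i\,\mathrm{tr}_{E/\mathbb{R}}(x)}$ and $$\mathcal{F}_1(g)=e^{-d\,\mathrm{tr}(g^*g)}|\det g|^{1/2}\qquad (g\in \mathrm{GL}_2(E)).$$ For $r>0$ let $\delta_r$ be the distribution $\delta_r(f)=\int_{\mathrm{GL}_2(E)^1}f(rg^1)\,dg^1$. For $h=\left(\begin{smallmatrix}1&t\\&1\end{smallmatrix}\right)\left(\begin{smallmatrix}zm&\\&z\end{smallmatrix}\right)k\in\mathrm{GL}_2(E)$ with $t\in E$, $z,m\in E^\times$, $k\in K$, let $\mathbb{W}_h$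 be the distribution $$\mathbb{W}_h(g)=\frac{\psi(t)|m|^{1/2}}{2}\,\bigl(\mathcal{F}_1\,\delta_{|m|^{1/(2d)}}\bigr)(z^{-1}g),$$ i.e. $\mathbb{W}_h(f)=\frac{\psi(t)|m|^{1/2}}{2}\int_{\mathrm{GL}_2(E)^1}\mathcal{F}_1(rg^1)f(zrg^1)\,dg^1$ with $r=|m|^{1/(2d)}$; it depends only on $h$. For $\Psi\in C_c^\infty(\mathrm{GL}_2(E))$ and a distribution $T$ put $(\Psi*T)(x)=\int\Psi(xy^{-1})\,dT(y)$. Let $U(\mathfrak{g})$ be the universal enveloping algebra of $\mathfrak{g}=\mathfrak{gl}_2(E)\otimes_{\mathbb{R}}\mathbb{C}$, where $\mathfrak{gl}_2(E)$ is regarded as a real Lie algebra. It acts on $C^\infty(\mathrm{GL}_2(E))$ from the left and from the right by convolution, $f\mapsto X*f*Y$; for $X\in\mathfrak{gl}_2(E)$ these actions are $(X*f)(g)=\frac{d}{dt}\big|_{t=0}f(\exp(-tX)g)$ and $(f*X)(g)=\frac{d}{dt}\big|_{t=0}f(g\exp(-tX))$. Let $\mathcal{C}(\mathrm{GL}_2(E))$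 be the Fréchet space of all smooth functions $f$ on $\mathrm{GL}_2(E)$ with $\|X*f*Y\|_1=\int_{\mathrm{GL}_2(E)}|X*f*Y|\,dg<\infty$ for all $X,Y\in U(\mathfrak{g})$. Then: 1. For all $\Psi\in C_c^\infty(\mathrm{GL}_2(E))$ and $g\in\mathrm{GL}_2(E)$, one has $\Psi*\mathbb{W}_g\in\mathcal{C}(\mathrm{GL}_2(E))$. 2. For all $\Psi\in C_c^\infty(\mathrm{GL}_2(E))$, $A>0$ and $X,Y\in U(\mathfrak{g})$ there is a constant $C$ such that for all $m\in E^\times$ with $|m|>1$ $$\bigl\|X*\Psi*\mathbb{W}_{\left(\begin{smallmatrix}m&\\&1\end{smallmatrix}\right)}*Y\bigr\|_1\le C\,|m|^{-A}.$$ 3. There is $B>0$ such that for all $\Psi\in C_c^\infty(\mathrm{GL}_2(E))$ and $X,Y\in U(\mathfrak{g})$ there is a constant $C$ such that for all $m\in E^\times$ with $|m|\le 1$ $$\bigl\|X*\Psi*\mathbb{W}_{\left(\begin{smallmatrix}m&\\&1\end{smallmatrix}\right)}*Y\bigr\|_1\le C\,|m|^{-B}.$$ -/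

import Mathlib

open Matrix MeasureTheory TensorProduct
open scoped ContDiff

attribute [local instance 100] LieRing.ofAssociativeRing

noncomputable section

namespace ArchGL2

/-! Throughout, `E` is an archimedean local field, that is `ℝ` or `ℂ`. -/

variable {E : Type*} [RCLike E]

/-! ### Absolute value, additive character -/

/-- The normalized absolute value `|x|` on `E`: the usual one on `ℝ`, its square on `ℂ`. -/
def absN (x : E) : ℝ := ‖x‖ ^ Module.finrank ℝ E

/-- The additive character `ψ(x) = exp(-2 π i tr_{E/ℝ} x)`. -/
def psi (x : E) : ℂ :=
  Complex.exp (-(2 * Real.pi * Complex.I * (Algebra.trace ℝ E x : ℂ)))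

/-! ### Smooth functions on `GL₂(E)` -/

/-- The normed real vector space underlying `M₂(E)`, with the sup norm of the entries. -/
abbrev Vec (E : Type*) [RCLike E] : Type _ := Fin 2 → Fin 2 → E

/-- The entries of `g`. -/
def toVec (g : GL (Fin 2) E) : Vec E := Matrix.of.symm (g : Matrix (Fin 2) (Fin 2) E)

/-- The function on `M₂(E)` that is `f` on the open subset `GL₂(E)` and zero elsewhere. -/
def ext (f : GL (Fin 2) E → ℂ) (A : Vec E) : ℂ :=
  open Classical in if h : IsUnit (Matrix.of A) then f h.unit else 0

/-- The open subset `GL₂(E)` of the real vector space `M₂(E)`. -/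
def unitSet (E : Type*) [RCLike E] : Set (Vec E) := {A | IsUnit (Matrix.of A)}

lemma isOpen_unitSet : IsOpen (unitSet E) := by
  have h : unitSet E = {A : Vec E | A 0 0 * A 1 1 - A 0 1 * A 1 0 ≠ 0} := by
    ext A; simp [unitSet, Matrix.isUnit_iff_isUnit_det, isUnit_iff_ne_zero, Matrix.det_fin_two]
  rw [h]
  exact isOpen_ne_fun (by fun_prop) continuous_const

lemma toVec_mem (g : GL (Fin 2) E) : toVec g ∈ unitSet E := g.isUnit

lemma ext_toVec (f : GL (Fin 2) E → ℂ) (g : GL (Fin 2) E) : ext f (toVec g) = f g := by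
  have h : IsUnit (Matrix.of (toVec g)) := g.isUnit
  simp only [ext, dif_pos h]
  congr 1
  exact Units.ext rfl

lemma toVec_unit {A : Vec E} (h : IsUnit (Matrix.of A)) : toVec h.unit = A := rfl

lemma ext_add (f g : GL (Fin 2) E → ℂ) : ext (f + g) = ext f + ext g := by
  funext A; by_cases hA : IsUnit (Matrix.of A) <;> simp [ext, hA]

lemma ext_smul (c : ℂ) (f : GL (Fin 2) E → ℂ) : ext (c • f) = c • ext f := by
  funext A; by_cases hA : IsUnit (Matrix.of A) <;> simp [ext, hA]

/-- `C^∞(GL₂(E))`: smooth complex-valued functions on the real Lie group `GL₂(E)`, which is an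
open subset of the real vector space `M₂(E)`. -/
def Smooth (E : Type*) [RCLike E] : Submodule ℂ (GL (Fin 2) E → ℂ) where
  carrier := {f | ContDiffOn ℝ ∞ (ext f) (unitSet E)}
  zero_mem' := (contDiffOn_const (c := (0 : ℂ))).congr fun A _ => by simp [ext]
  add_mem' {f g} hf hg := by
    change ContDiffOn ℝ ∞ (ext (f + g)) (unitSet E)
    rw [ext_add]; exact ContDiffOn.add hf hg
  smul_mem' c f hf := by
    change ContDiffOn ℝ ∞ (ext (c • f)) (unitSet E)
    rw [ext_smul]; exact ContDiffOn.const_smul c hf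

/-- `C_c^∞(GL₂(E))`. -/
def TestFun (E : Type*) [RCLike E] : Set (GL (Fin 2) E → ℂ) :=
  {f | f ∈ Smooth E ∧ HasCompactSupport f}

/-! ### The action of `U(𝔤)` on `C^∞(GL₂(E))` from the left and from the right

An element of the universal enveloping algebra is a distribution supported at the identity:
`X ∈ M₂(E)` is `φ ↦ d/dt φ(exp(tX))` at `t = 0`. Hence
`(X * f)(g) = d/dt f(exp(-tX) g)` is the derivative of `f` at `g` in the direction `-Xg`, and
`(f * X)(g) = d/dt f(g exp(-tX))` is the derivative of `f` at `g` in the direction `-gX`. -/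

/-- The derivative of `f` along the vector field `v` on `M₂(E)`. -/
def derivAlong (v : Vec E →L[ℝ] Vec E) (f : GL (Fin 2) E → ℂ) (g : GL (Fin 2) E) : ℂ :=
  fderiv ℝ (ext f) (toVec g) (v (toVec g))

lemma ext_derivAlong (v : Vec E →L[ℝ] Vec E) (f : GL (Fin 2) E → ℂ) {A : Vec E}
    (hA : A ∈ unitSet E) : ext (derivAlong v f) A = fderiv ℝ (ext f) A (v A) := by
  have h : IsUnit (Matrix.of A) := hA
  simp [ext, h, derivAlong, toVec_unit]

lemma contDiffAt_ext (f : Smooth E) {A : Vec E} (hA : A ∈ unitSet E) :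
    ContDiffAt ℝ ∞ (ext (f : GL (Fin 2) E → ℂ)) A :=
  (f.2 : ContDiffOn ℝ ∞ _ _).contDiffAt (isOpen_unitSet.mem_nhds hA)

lemma differentiableAt_ext (f : Smooth E) (g : GL (Fin 2) E) :
    DifferentiableAt ℝ (ext (f : GL (Fin 2) E → ℂ)) (toVec g) :=
  (contDiffAt_ext f (toVec_mem g)).differentiableAt (by simp)

lemma derivAlong_mem (v : Vec E →L[ℝ] Vec E) (f : Smooth E) :
    derivAlong v (f : GL (Fin 2) E → ℂ) ∈ Smooth E := by
  have h1 : ContDiffOn ℝ ∞ (fderiv ℝ (ext (f : GL (Fin 2) E → ℂ))) (unitSet E) :=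
    ContDiffOn.fderiv_of_isOpen f.2 isOpen_unitSet (by simp)
  exact (h1.clm_apply v.contDiff.contDiffOn).congr fun A hA => ext_derivAlong v _ hA

/-- `derivAlong v` as an endomorphism of `C^∞(GL₂(E))`. -/
def derivEnd (v : Vec E →L[ℝ] Vec E) : Module.End ℂ (Smooth E) where
  toFun f := ⟨derivAlong v f, derivAlong_mem v f⟩
  map_add' f g := by
    ext x
    simp [derivAlong, ext_add, fderiv_add (differentiableAt_ext f x) (differentiableAt_ext g x)]
  map_smul' c f := by
    ext x
    simp [derivAlong, ext_smul, fderiv_const_smul (differentiableAt_ext f x) c]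

lemma derivEnd_apply (v : Vec E →L[ℝ] Vec E) (f : Smooth E) (g : GL (Fin 2) E) :
    (derivEnd v f : GL (Fin 2) E → ℂ) g
      = fderiv ℝ (ext (f : GL (Fin 2) E → ℂ)) (toVec g) (v (toVec g)) := rfl

lemma derivEnd_add (v w : Vec E →L[ℝ] Vec E) :
    derivEnd (v + w) = derivEnd v + derivEnd w := by
  ext f g; simp [derivEnd_apply]

lemma derivEnd_smul (c : ℝ) (v : Vec E →L[ℝ] Vec E) : derivEnd (c • v) = c • derivEnd v := by
  ext f g
  change _ = c • (derivEnd v f : GL (Fin 2) E → ℂ) g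
  simp [derivEnd_apply]

/-- The commutator of two linear vector fields, as operators on functions. -/
lemma derivEnd_comm (v w : Vec E →L[ℝ] Vec E) :
    derivEnd v * derivEnd w - derivEnd w * derivEnd v = derivEnd (w * v - v * w) := by
  have key : ∀ (v w : Vec E →L[ℝ] Vec E) (f : Smooth E)
      (g : GL (Fin 2) E), (derivEnd v (derivEnd w f) : GL (Fin 2) E → ℂ) g
      = fderiv ℝ (fderiv ℝ (ext (f : GL (Fin 2) E → ℂ))) (toVec g) (v (toVec g)) (w (toVec g))
        + fderiv ℝ (ext (f : GL (Fin 2) E → ℂ)) (toVec g) (w (v (toVec g))) := by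
    intro v w f g
    have hU := isOpen_unitSet.mem_nhds (toVec_mem g)
    have hev : ext (derivEnd w f : GL (Fin 2) E → ℂ)
        =ᶠ[nhds (toVec g)] fun A => fderiv ℝ (ext (f : GL (Fin 2) E → ℂ)) A (w A) := by
      filter_upwards [hU] with A hA
      exact ext_derivAlong w f hA
    have hd : DifferentiableAt ℝ (fderiv ℝ (ext (f : GL (Fin 2) E → ℂ))) (toVec g) :=
      ((contDiffAt_ext f (toVec_mem g)).fderiv_right (m := 1)
        (by norm_cast)).differentiableAt (by simp)
    rw [derivEnd_apply, hev.fderiv_eq]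
    rw [fderiv_clm_apply hd w.differentiableAt]
    simp [add_comm]
  ext f g
  have hs : IsSymmSndFDerivAt ℝ (ext (f : GL (Fin 2) E → ℂ)) (toVec g) :=
    (contDiffAt_ext f (toVec_mem g)).isSymmSndFDerivAt (by simp; norm_cast)
  have e1 := key v w f g
  have e2 := key w v f g
  have e3 := hs (v (toVec g)) (w (toVec g))
  change (derivEnd v (derivEnd w f) : GL (Fin 2) E → ℂ) g
    - (derivEnd w (derivEnd v f) : GL (Fin 2) E → ℂ) g = _
  rw [e1, e2, e3, derivEnd_apply]
  simp

/-- The vector field `A ↦ -X A`. -/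
def leftField (X : Matrix (Fin 2) (Fin 2) E) : Vec E →L[ℝ] Vec E :=
  LinearMap.toContinuousLinearMap
    { toFun := fun A => Matrix.of.symm (-(X * Matrix.of A))
      map_add' := fun A B => congrArg Matrix.of.symm
        (show -(X * (Matrix.of A + Matrix.of B)) = -(X * Matrix.of A) + -(X * Matrix.of B) by
          rw [mul_add, neg_add])
      map_smul' := fun c A => congrArg Matrix.of.symm
        (show -(X * (c • Matrix.of A)) = c • -(X * Matrix.of A) by
          rw [mul_smul_comm, smul_neg]) }

/-- The vector field `A ↦ -A X`. -/
def rightField (X : Matrix (Fin 2) (Fin 2) E) : Vec E →L[ℝ] Vec E :=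
  LinearMap.toContinuousLinearMap
    { toFun := fun A => Matrix.of.symm (-(Matrix.of A * X))
      map_add' := fun A B => congrArg Matrix.of.symm
        (show -((Matrix.of A + Matrix.of B) * X) = -(Matrix.of A * X) + -(Matrix.of B * X) by
          rw [add_mul, neg_add])
      map_smul' := fun c A => congrArg Matrix.of.symm
        (show -((c • Matrix.of A) * X) = c • -(Matrix.of A * X) by
          rw [smul_mul_assoc, smul_neg]) }

lemma leftField_apply (X : Matrix (Fin 2) (Fin 2) E) (A : Vec E) :
    leftField X A = Matrix.of.symm (-(X * Matrix.of A)) := rfl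

lemma rightField_apply (X : Matrix (Fin 2) (Fin 2) E) (A : Vec E) :
    rightField X A = Matrix.of.symm (-(Matrix.of A * X)) := rfl

lemma leftField_add (X Y : Matrix (Fin 2) (Fin 2) E) :
    leftField (X + Y) = leftField X + leftField Y := by
  ext1 A
  exact congrArg Matrix.of.symm
    (show -((X + Y) * Matrix.of A) = -(X * Matrix.of A) + -(Y * Matrix.of A) by
      rw [add_mul, neg_add])

lemma leftField_smul (c : ℝ) (X : Matrix (Fin 2) (Fin 2) E) :
    leftField (c • X) = c • leftField X := by
  ext1 A
  exact congrArg Matrix.of.symm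
    (show -((c • X) * Matrix.of A) = c • -(X * Matrix.of A) by rw [smul_mul_assoc, smul_neg])

lemma leftField_lie (X Y : Matrix (Fin 2) (Fin 2) E) :
    leftField (X * Y - Y * X) = leftField Y * leftField X - leftField X * leftField Y := by
  ext1 A
  exact congrArg Matrix.of.symm
    (show -((X * Y - Y * X) * Matrix.of A)
        = -(Y * -(X * Matrix.of A)) - -(X * -(Y * Matrix.of A)) by noncomm_ring)

lemma rightField_add (X Y : Matrix (Fin 2) (Fin 2) E) :
    rightField (X + Y) = rightField X + rightField Y := by
  ext1 A
  exact congrArg Matrix.of.symm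
    (show -(Matrix.of A * (X + Y)) = -(Matrix.of A * X) + -(Matrix.of A * Y) by
      rw [mul_add, neg_add])

lemma rightField_smul (c : ℝ) (X : Matrix (Fin 2) (Fin 2) E) :
    rightField (c • X) = c • rightField X := by
  ext1 A
  exact congrArg Matrix.of.symm
    (show -(Matrix.of A * (c • X)) = c • -(Matrix.of A * X) by rw [mul_smul_comm, smul_neg])

lemma rightField_lie (X Y : Matrix (Fin 2) (Fin 2) E) :
    rightField (X * Y - Y * X) = rightField X * rightField Y - rightField Y * rightField X := by
  ext1 A
  exact congrArg Matrix.of.symm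
    (show -(Matrix.of A * (X * Y - Y * X))
        = -(-(Matrix.of A * Y) * X) - -(-(Matrix.of A * X) * Y) by noncomm_ring)

/-- `X ↦ (f ↦ X * f)`, a homomorphism of real Lie algebras. -/
def leftLie : Matrix (Fin 2) (Fin 2) E →ₗ⁅ℝ⁆ Module.End ℂ (Smooth E) where
  toFun X := derivEnd (leftField X)
  map_add' X Y := by rw [← derivEnd_add, leftField_add]
  map_smul' c X := by rw [RingHom.id_apply, ← derivEnd_smul, leftField_smul]
  map_lie' {X Y} :=
    show derivEnd (leftField (X * Y - Y * X))
        = derivEnd (leftField X) * derivEnd (leftField Y)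
          - derivEnd (leftField Y) * derivEnd (leftField X) by
      rw [derivEnd_comm, leftField_lie]

/-- `X ↦ (f ↦ f * X)`, a homomorphism of real Lie algebras to the opposite algebra. -/
def rightLie : Matrix (Fin 2) (Fin 2) E →ₗ⁅ℝ⁆ (Module.End ℂ (Smooth E))ᵐᵒᵖ where
  toFun X := MulOpposite.op (derivEnd (rightField X))
  map_add' X Y := by rw [← MulOpposite.op_add, ← derivEnd_add, rightField_add]
  map_smul' c X := by
    rw [RingHom.id_apply, ← MulOpposite.op_smul, ← derivEnd_smul, rightField_smul]
  map_lie' {X Y} :=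
    show MulOpposite.op (derivEnd (rightField (X * Y - Y * X)))
        = MulOpposite.op (derivEnd (rightField Y) * derivEnd (rightField X)
          - derivEnd (rightField X) * derivEnd (rightField Y)) by
      rw [derivEnd_comm, rightField_lie]

/-- The complexified Lie algebra `Res_{E/ℝ} 𝔤𝔩₂ ⊗_ℝ ℂ`. -/
abbrev LieC (E : Type*) [RCLike E] : Type _ := ℂ ⊗[ℝ] Matrix (Fin 2) (Fin 2) E

/-- The universal enveloping algebra `U(Res_{E/ℝ} 𝔤𝔩₂ ⊗_ℝ ℂ)`. -/
abbrev UEnv (E : Type*) [RCLike E] : Type _ := UniversalEnvelopingAlgebra ℂ (LieC E)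

/-- The complex-linear extension of a homomorphism of real Lie algebras into a complex algebra. -/
def complexify {L A : Type*} [LieRing L] [LieAlgebra ℝ L] [Ring A] [Algebra ℂ A] [Algebra ℝ A]
    [IsScalarTower ℝ ℂ A] (φ : L →ₗ⁅ℝ⁆ A) : ℂ ⊗[ℝ] L →ₗ⁅ℂ⁆ A :=
  { LinearMap.liftBaseChange ℂ (φ : L →ₗ[ℝ] A) with
    map_lie' := by
      intro x y
      change LinearMap.liftBaseChange ℂ (φ : L →ₗ[ℝ] A) ⁅x, y⁆
        = ⁅LinearMap.liftBaseChange ℂ (φ : L →ₗ[ℝ] A) x,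
           LinearMap.liftBaseChange ℂ (φ : L →ₗ[ℝ] A) y⁆
      induction x using TensorProduct.induction_on with
      | zero => rw [zero_lie, map_zero, zero_lie]
      | add a b ha hb => rw [add_lie, map_add, map_add, ha, hb, add_lie]
      | tmul s X =>
        induction y using TensorProduct.induction_on with
        | zero =>
          have e := @lie_zero (ℂ ⊗[ℝ] L) (ℂ ⊗[ℝ] L) _ _ lieRingSelfModule (s ⊗ₜ[ℝ] X)
          erw [e]
          rw [map_zero, lie_zero]
        | add a b ha hb =>
          have e := @lie_add (ℂ ⊗[ℝ] L) (ℂ ⊗[ℝ] L) _ _ lieRingSelfModule (s ⊗ₜ[ℝ] X) a b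
          erw [e]
          rw [map_add, map_add, lie_add, ← ha, ← hb]
        | tmul t Y =>
          have h : φ ⁅X, Y⁆ = φ X * φ Y - φ Y * φ X := φ.map_lie X Y
          change (s * t) • φ ⁅X, Y⁆ = (s • φ X) * (t • φ Y) - (t • φ Y) * (s • φ X)
          rw [h]
          simp only [smul_sub, smul_mul_assoc, mul_smul_comm, smul_smul, mul_comm t s] }

/-- The left action of `U(𝔤)` on `C^∞(GL₂(E))`, `leftAct X f = X * f`. -/
def leftAct : UEnv E →ₐ[ℂ] Module.End ℂ (Smooth E) :=
  UniversalEnvelopingAlgebra.lift ℂ (complexify (leftLie (E := E)))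

/-- The right action of `U(𝔤)` on `C^∞(GL₂(E))`, `(rightAct Y).unop f = f * Y`. -/
def rightAct : UEnv E →ₐ[ℂ] (Module.End ℂ (Smooth E))ᵐᵒᵖ :=
  UniversalEnvelopingAlgebra.lift ℂ (complexify (rightLie (E := E)))

lemma leftAct_ι (c : ℂ) (X : Matrix (Fin 2) (Fin 2) E) :
    leftAct (UniversalEnvelopingAlgebra.ι ℂ (c ⊗ₜ[ℝ] X)) = c • derivEnd (leftField X) :=
  UniversalEnvelopingAlgebra.lift_ι_apply ℂ (complexify (leftLie (E := E))) (c ⊗ₜ[ℝ] X)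

lemma rightAct_ι (c : ℂ) (X : Matrix (Fin 2) (Fin 2) E) :
    (rightAct (UniversalEnvelopingAlgebra.ι ℂ (c ⊗ₜ[ℝ] X))).unop = c • derivEnd (rightField X) :=
  congrArg MulOpposite.unop
    (UniversalEnvelopingAlgebra.lift_ι_apply ℂ (complexify (rightLie (E := E))) (c ⊗ₜ[ℝ] X))

/-- `X * f * Y`. -/
def biAct (X Y : UEnv E) (f : Smooth E) : Smooth E :=
  leftAct X ((rightAct Y).unop f)

/-! ### The space `𝒞(GL₂(E))` -/

instance : MeasurableSpace (GL (Fin 2) E) := borel _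

instance : BorelSpace (GL (Fin 2) E) := ⟨rfl⟩

/-- `‖X * f * Y‖₁`, the `L¹`-norm with respect to the measure `μ`; it is `∞` if `f` is not
smooth. -/
def l1Norm (μ : Measure (GL (Fin 2) E)) (X Y : UEnv E) (f : GL (Fin 2) E → ℂ) : ENNReal :=
  ⨅ hf : f ∈ Smooth E, ∫⁻ g, ‖(biAct X Y ⟨f, hf⟩ : GL (Fin 2) E → ℂ) g‖ₑ ∂μ

/-- `𝒞(GL₂(E))`: the smooth functions `f` with `‖X * f * Y‖₁ < ∞` for all `X, Y ∈ U(𝔤)`. -/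
def CSpace (μ : Measure (GL (Fin 2) E)) : Set (GL (Fin 2) E → ℂ) :=
  {f | f ∈ Smooth E ∧ ∀ X Y : UEnv E, l1Norm μ X Y f < ⊤}

/-! ### Distributions and convolution -/

/-- A distribution on `GL₂(E)`, given by its values on test functions. -/
abbrev Distrib (E : Type*) [RCLike E] : Type _ := (GL (Fin 2) E → ℂ) → ℂ

/-- The convolution `(Ψ * T)(x) = ∫ Ψ(x y⁻¹) dT(y)`. -/
def conv (Ψ : GL (Fin 2) E → ℂ) (T : Distrib E) (x : GL (Fin 2) E) : ℂ :=
  T fun y => Ψ (x * y⁻¹)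

/-- The product of the distribution `T` with the function `F`. -/
def fmul (F : GL (Fin 2) E → ℂ) (T : Distrib E) : Distrib E :=
  fun f => T fun g => F g * f g

/-- The translate `T(a⁻¹ g)` of the distribution `T(g)`. -/
def translate (a : GL (Fin 2) E) (T : Distrib E) : Distrib E :=
  fun f => T fun g => f (a * g)

/-- `GL₂(E)¹`, the kernel of `|det|`. -/
def GL1 (E : Type*) [RCLike E] : Subgroup (GL (Fin 2) E) where
  carrier := {g | absN (g : Matrix (Fin 2) (Fin 2) E).det = 1}
  one_mem' := by simp [absN]
  mul_mem' {a b} ha hb := by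
    simp only [Set.mem_ofPred_eq, absN] at ha hb ⊢
    rw [Units.val_mul, Matrix.det_mul, norm_mul, mul_pow, ha, hb, one_mul]
  inv_mem' {a} ha := by
    simp only [Set.mem_ofPred_eq, absN] at ha ⊢
    have h : (a : Matrix (Fin 2) (Fin 2) E).det * ((a⁻¹ : GL (Fin 2) E) :
        Matrix (Fin 2) (Fin 2) E).det = 1 := by
      rw [← Matrix.det_mul, ← Units.val_mul, mul_inv_cancel, Units.val_one, Matrix.det_one]
    have h2 := congrArg (fun x : E => ‖x‖ ^ Module.finrank ℝ E) h
    simp only [norm_mul, mul_pow, ha, norm_one, one_pow, one_mul] at h2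
    exact h2

/-- A positive real number as an element of `Eˣ`. -/
def posUnit (r : Set.Ioi (0 : ℝ)) : Eˣ :=
  Units.mk0 ((r : ℝ) : E) (by exact_mod_cast r.2.ne')

/-- The distribution `δ_r`, `f ↦ ∫_{GL₂(E)¹} f(r g¹) dg¹`, for the measure `dg¹ = ν`. -/
def delta (ν : Measure (GL1 E)) (r : Set.Ioi (0 : ℝ)) : Distrib E :=
  fun f => ∫ g : GL1 E, f (GeneralLinearGroup.scalar (Fin 2) (posUnit r) * (g : GL (Fin 2) E)) ∂ν

/-- `𝓕₁(g) = exp(-[E:ℝ] tr(g^* g)) |det g|^{1/2}`. -/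
def F1 (g : GL (Fin 2) E) : ℂ :=
  ((Real.exp (-(Module.finrank ℝ E : ℝ) * RCLike.re
      (((g : Matrix (Fin 2) (Fin 2) E)ᴴ * (g : Matrix (Fin 2) (Fin 2) E)).trace))
    * absN (g : Matrix (Fin 2) (Fin 2) E).det ^ (1 / 2 : ℝ) : ℝ) : ℂ)

/-! ### The distributions `𝕎_h` -/

/-- `diag(a, b)`. -/
def diagGL (a b : Eˣ) : GL (Fin 2) E :=
  ⟨!![(a : E), 0; 0, (b : E)], !![((a⁻¹ : Eˣ) : E), 0; 0, ((b⁻¹ : Eˣ) : E)],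
    by simp [Matrix.one_fin_two], by simp [Matrix.one_fin_two]⟩

/-- `h = (1 t; 0 1) diag(z m, z) k` with `k` in the standard maximal compact subgroup `K`, which
is `O(2)` or `U(2)`. -/
def IsIwasawa (h : GL (Fin 2) E) (t : E) (z m : Eˣ) (k : GL (Fin 2) E) : Prop :=
  (k : Matrix (Fin 2) (Fin 2) E) ∈ Matrix.unitaryGroup (Fin 2) E ∧
    h = GeneralLinearGroup.upperRightHom t * diagGL (z * m) z * k

lemma absN_pos (m : Eˣ) : 0 < absN (m : E) := pow_pos (norm_pos_iff.2 m.ne_zero) _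

/-- `|m|^{1/(2[E:ℝ])}`. -/
def rootAbs (m : Eˣ) : Set.Ioi (0 : ℝ) :=
  ⟨absN (m : E) ^ (1 / (2 * Module.finrank ℝ E : ℝ)), Real.rpow_pos_of_pos (absN_pos m) _⟩

/-- `(ψ(t) |m|^{1/2} / 2) · (𝓕₁ δ_{|m|^{1/(2[E:ℝ])}})(z⁻¹ g)`. -/
def WCoord (ν : Measure (GL1 E)) (t : E) (z m : Eˣ) : Distrib E :=
  (psi t * (absN (m : E) ^ (1 / 2 : ℝ) : ℝ) / 2) •
    translate (GeneralLinearGroup.scalar (Fin 2) z) (fmul F1 (delta ν (rootAbs m)))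

lemma IsIwasawa.coe_eq {h : GL (Fin 2) E} {t : E} {z m : Eˣ} {k : GL (Fin 2) E}
    (hh : IsIwasawa h t z m k) : (h : Matrix (Fin 2) (Fin 2) E)
      = !![(z : E) * m, t * z; 0, (z : E)] * (k : Matrix (Fin 2) (Fin 2) E) := by
  have h1 := congrArg (fun x : GL (Fin 2) E => (x : Matrix (Fin 2) (Fin 2) E)) hh.2
  simp only [Units.val_mul] at h1
  rw [h1]
  congr 1
  simp [GeneralLinearGroup.upperRightHom, diagGL]

lemma exists_isIwasawa (h : GL (Fin 2) E) : ∃ t z m k, IsIwasawa h t z m k := by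
  obtain ⟨H, hH⟩ : ∃ H : Matrix (Fin 2) (Fin 2) E, H = (h : Matrix (Fin 2) (Fin 2) E) := ⟨_, rfl⟩
  have hdet : H 0 0 * H 1 1 - H 0 1 * H 1 0 ≠ 0 := by
    rw [← Matrix.det_fin_two, hH]
    exact (Matrix.isUnit_iff_isUnit_det _ |>.1 h.isUnit).ne_zero
  obtain ⟨a, ha⟩ : ∃ a, a = H 0 0 := ⟨_, rfl⟩
  obtain ⟨b, hb⟩ : ∃ a, a = H 0 1 := ⟨_, rfl⟩
  obtain ⟨c, hc⟩ : ∃ a, a = H 1 0 := ⟨_, rfl⟩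
  obtain ⟨d, hd⟩ : ∃ a, a = H 1 1 := ⟨_, rfl⟩
  rw [← ha, ← hb, ← hc, ← hd] at hdet
  have hpos : 0 < ‖c‖ ^ 2 + ‖d‖ ^ 2 := by
    by_contra hle
    have hc0 : c = 0 := by
      have : ‖c‖ = 0 := by nlinarith [sq_nonneg ‖c‖, sq_nonneg ‖d‖]
      simpa using this
    have hd0 : d = 0 := by
      have : ‖d‖ = 0 := by nlinarith [sq_nonneg ‖c‖, sq_nonneg ‖d‖]
      simpa using this
    exact hdet (by simp [hc0, hd0])
  obtain ⟨n, hn⟩ : ∃ n : E, n = ((Real.sqrt (‖c‖ ^ 2 + ‖d‖ ^ 2) : ℝ) : E) := ⟨_, rfl⟩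
  have hn0 : n ≠ 0 := by
    rw [hn]; exact_mod_cast (Real.sqrt_pos.2 hpos).ne'
  have hsn : (starRingEnd E) n = n := by rw [hn, RCLike.conj_ofReal]
  have hnn : n * n = c * (starRingEnd E) c + d * (starRingEnd E) d := by
    rw [RCLike.mul_conj, RCLike.mul_conj, hn, ← RCLike.ofReal_mul, Real.mul_self_sqrt hpos.le]
    push_cast; rfl
  obtain ⟨K, hK⟩ : ∃ K : Matrix (Fin 2) (Fin 2) E,
      K = !![(starRingEnd E) d / n, -(starRingEnd E) c / n; c / n, d / n] := ⟨_, rfl⟩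
  have hKstar : star K = !![d / n, (starRingEnd E) c / n; -c / n, (starRingEnd E) d / n] := by
    rw [Matrix.star_eq_conjTranspose, hK]
    ext i j
    fin_cases i <;> fin_cases j <;> simp [hsn]
  have hKK : K * star K = 1 := by
    rw [hKstar, hK, Matrix.mul_fin_two, Matrix.one_fin_two]
    congr 1
    ext i j
    fin_cases i <;> fin_cases j <;> simp <;> field_simp <;> first | linear_combination -hnn | ring
  have hKK' : star K * K = 1 := mul_eq_one_comm.1 hKK
  refine ⟨(a * (starRingEnd E) c + b * (starRingEnd E) d) / (n * n), Units.mk0 n hn0,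
    Units.mk0 ((a * d - b * c) / (n * n)) (div_ne_zero hdet (mul_ne_zero hn0 hn0)),
    ⟨K, star K, hKK, hKK'⟩, ?_, ?_⟩
  · exact Matrix.mem_unitaryGroup_iff.2 hKK
  · apply Units.ext
    have e : (h : Matrix (Fin 2) (Fin 2) E) = !![a, b; c, d] := by
      rw [← hH, ha, hb, hc, hd]; exact Matrix.eta_fin_two H
    rw [e]
    simp only [Units.val_mul]
    have e2 : ((GeneralLinearGroup.upperRightHom
        ((a * (starRingEnd E) c + b * (starRingEnd E) d) / (n * n)) : GL (Fin 2) E) :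
          Matrix (Fin 2) (Fin 2) E)
        = !![1, (a * (starRingEnd E) c + b * (starRingEnd E) d) / (n * n); 0, 1] := by
      simp [GeneralLinearGroup.upperRightHom]
    rw [e2, hK]
    simp only [diagGL, Units.val_mk0, Units.val_mul, Matrix.mul_fin_two]
    ext i j
    fin_cases i <;> fin_cases j <;> simp <;> field_simp
    · linear_combination a * hnn
    · linear_combination b * hnn

lemma norm_eq_of_mul_conj {x y : E} (h : x * (starRingEnd E) x = y * (starRingEnd E) y) :
    ‖x‖ = ‖y‖ := by
  rw [RCLike.mul_conj, RCLike.mul_conj] at h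
  have h2 : ‖x‖ ^ 2 = ‖y‖ ^ 2 := by exact_mod_cast h
  exact (sq_eq_sq₀ (norm_nonneg _) (norm_nonneg _)).1 h2

/-- In the Iwasawa decomposition `t`, `|z|` and `|m|` are unique. -/
lemma IsIwasawa.unique {h k k' : GL (Fin 2) E} {t t' : E} {z z' m m' : Eˣ}
    (hh : IsIwasawa h t z m k) (hh' : IsIwasawa h t' z' m' k') :
    t = t' ∧ ‖(z : E)‖ = ‖(z' : E)‖ ∧ ‖(m : E)‖ = ‖(m' : E)‖ := by
  have key : ∀ {t : E} {z m : Eˣ} {k : GL (Fin 2) E}, IsIwasawa h t z m k →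
      (h : Matrix (Fin 2) (Fin 2) E) * star (h : Matrix (Fin 2) (Fin 2) E)
        = !![(z : E) * m, t * z; 0, (z : E)] * star !![(z : E) * m, t * z; 0, (z : E)] := by
    intro t z m k hh
    rw [hh.coe_eq, star_mul]
    have := Matrix.mem_unitaryGroup_iff.1 hh.1
    rw [mul_assoc, ← mul_assoc (k : Matrix (Fin 2) (Fin 2) E), this, one_mul]
  have e := (key hh).symm.trans (key hh')
  have e11 := congrFun (congrFun e 1) 1
  have e01 := congrFun (congrFun e 0) 1
  have e00 := congrFun (congrFun e 0) 0
  simp [Matrix.mul_apply, Fin.sum_univ_two, Matrix.star_eq_conjTranspose,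
    Matrix.conjTranspose_apply] at e11 e01 e00
  have hz : (z : E) ≠ 0 := z.ne_zero
  have hz' : (z' : E) ≠ 0 := z'.ne_zero
  have hzc : (starRingEnd E) (z' : E) ≠ 0 := by simp
  have ht : t = t' := by
    have : (z' : E) * (starRingEnd E) (z' : E) ≠ 0 := mul_ne_zero hz' hzc
    apply mul_right_cancel₀ this
    linear_combination e01 - t * e11
  subst ht
  have hn := norm_eq_of_mul_conj e11
  refine ⟨rfl, hn, ?_⟩
  have e3 : ((z : E) * m) * (starRingEnd E) ((z : E) * m)
      = ((z' : E) * m') * (starRingEnd E) ((z' : E) * m') := by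
    simp only [map_mul]
    linear_combination e00 - t * (starRingEnd E) t * e11
  have h4 := norm_eq_of_mul_conj e3
  rw [norm_mul, norm_mul, hn] at h4
  exact mul_left_cancel₀ (norm_ne_zero_iff.2 hz') h4

lemma F1_scalar_mul {u : Eˣ} (hu : ‖(u : E)‖ = 1) (g : GL (Fin 2) E) :
    F1 (GeneralLinearGroup.scalar (Fin 2) u * g) = F1 g := by
  have hc : ((GeneralLinearGroup.scalar (Fin 2) u * g : GL (Fin 2) E) : Matrix (Fin 2) (Fin 2) E)
      = (u : E) • (g : Matrix (Fin 2) (Fin 2) E) := by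
    ext i j
    simp [GeneralLinearGroup.scalar]
  have huu : (starRingEnd E) (u : E) * (u : E) = 1 := by
    rw [RCLike.conj_mul, hu]; simp
  have h1 : ((u : E) • (g : Matrix (Fin 2) (Fin 2) E))ᴴ * ((u : E) • (g : Matrix (Fin 2) (Fin 2) E))
      = (g : Matrix (Fin 2) (Fin 2) E)ᴴ * (g : Matrix (Fin 2) (Fin 2) E) := by
    rw [Matrix.conjTranspose_smul, smul_mul_assoc, mul_smul_comm, smul_smul]
    change ((starRingEnd E) (u : E) * (u : E)) • _ = _
    rw [huu, one_smul]
  simp only [F1, hc, h1, absN, Matrix.det_smul, norm_mul, norm_pow, hu, one_pow, one_mul]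

lemma absN_congr {x y : E} (h : ‖x‖ = ‖y‖) : absN x = absN y := by simp only [absN, h]

lemma WCoord_congr (ν : Measure (GL1 E)) [ν.IsMulLeftInvariant] (t : E) {z z' m m' : Eˣ}
    (h2 : ‖(z' : E)‖ = ‖(z : E)‖) (h3 : ‖(m' : E)‖ = ‖(m : E)‖) :
    WCoord ν t z' m' = WCoord ν t z m := by
  have hr : rootAbs m' = rootAbs m := by
    apply Subtype.ext; simp only [rootAbs, absN_congr h3]
  simp only [WCoord, absN_congr h3, hr]
  congr 1
  funext f
  obtain ⟨u, hu⟩ : ∃ u : Eˣ, z' = z * u := ⟨z⁻¹ * z', by simp⟩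
  have hu1 : ‖(u : E)‖ = 1 := by
    rw [hu, Units.val_mul, norm_mul] at h2
    have : ‖(z : E)‖ ≠ 0 := norm_ne_zero_iff.2 z.ne_zero
    exact mul_left_cancel₀ this (by rw [h2, mul_one])
  have hmem : GeneralLinearGroup.scalar (Fin 2) u ∈ GL1 E := by
    change absN _ = 1
    have : ((GeneralLinearGroup.scalar (Fin 2) u : GL (Fin 2) E) : Matrix (Fin 2) (Fin 2) E).det
        = (u : E) ^ 2 := by
      simp [GeneralLinearGroup.scalar, pow_two]
    rw [this, absN, norm_pow, hu1]; simp
  have := integral_mul_left_eq_self (μ := ν) (fun g : GL1 E =>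
    F1 (GeneralLinearGroup.scalar (Fin 2) (posUnit (rootAbs m)) * (g : GL (Fin 2) E)) *
      f (GeneralLinearGroup.scalar (Fin 2) z *
        (GeneralLinearGroup.scalar (Fin 2) (posUnit (rootAbs m)) * (g : GL (Fin 2) E))))
    ⟨_, hmem⟩
  simp only [translate, fmul, delta]
  rw [← this]
  congr 1
  funext g
  have hcomm : GeneralLinearGroup.scalar (Fin 2) (posUnit (rootAbs m)) *
      (GeneralLinearGroup.scalar (Fin 2) u * (g : GL (Fin 2) E))
      = GeneralLinearGroup.scalar (Fin 2) u *
        (GeneralLinearGroup.scalar (Fin 2) (posUnit (rootAbs m)) * (g : GL (Fin 2) E)) := by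
    rw [← mul_assoc, ← mul_assoc, ← map_mul, ← map_mul, mul_comm u]
  simp only [Subgroup.coe_mul]
  rw [hcomm, F1_scalar_mul hu1, hu, map_mul]
  simp only [mul_assoc]

/-- The distribution `𝕎_h`: `WCoord ν t z m` for `h = (1 t; 0 1) diag(z m, z) k`, `k ∈ K`. -/
def W (ν : Measure (GL1 E)) (h : GL (Fin 2) E) : Distrib E :=
  WCoord ν (exists_isIwasawa h).choose (exists_isIwasawa h).choose_spec.choose
    (exists_isIwasawa h).choose_spec.choose_spec.choose

/-- `𝕎_h` does not depend on the chosen decomposition of `h`. -/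
theorem W_eq (ν : Measure (GL1 E)) [ν.IsMulLeftInvariant] {h k : GL (Fin 2) E} {t : E} {z m : Eˣ}
    (hh : IsIwasawa h t z m k) : W ν h = WCoord ν t z m := by
  have hs := (exists_isIwasawa h).choose_spec.choose_spec.choose_spec.choose_spec
  obtain ⟨h1, h2, h3⟩ := hs.unique hh
  unfold W
  exact (WCoord_congr ν _ h2 h3).trans (by rw [h1])

end ArchGL2

end

noncomputable section

namespace ArchGL2

variable {E : Type*} [RCLike E]

/-! ### Topology of `GL₂(E)` and `GL₂(E)¹` -/

section Topology

-- Write `ρ(x) = |det x|^{1/2}` (usual absolute value) and `r = |m|^{1/(2d)}`. In the integral over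
-- `GL₂(E)¹` that defines `(Ψ * 𝕎_h)(x)`, substitute `g ↦ g · x/ρ(x)`, which is allowed because
-- `GL₂(E)¹` is unimodular. The Gaussian is then evaluated at `g B` with `B = (r/ρ(x)) x`, and `Ψ`
-- at `z⁻¹ σ g⁻¹` with `σ = ρ(x)/r`. Hence `Ψ * 𝕎_h` is `ψ(t)|m|/2` times the pullback under `x ↦
-- (σ, B)` of a single function `Θ` on `ℝ × M₂(E)`, which depends on `Ψ` and `z` but not on `t` or
-- `m` (`conv_WCoord`).
--
-- The function `Θ` is Schwartz and vanishes for small `|σ|` (`exists_kernel`): compactness of the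
-- support of `Ψ` confines `g` to a fixed compact set and bounds `|σ|` from below, so `Θ` is an
-- average, over a compact family of injective linear maps, of one Schwartz function on `M₂(E) ×
-- M₂(E)`.
--
-- Left and right invariant vector fields multiply `det` infinitesimally by a constant, so in the
-- coordinates `(σ, B)` they become linear vector fields that do not involve `r`. Such fields
-- preserve Schwartz functions and the vanishing for small `|σ|`. Therefore `X * Ψ * 𝕎_h * Y` is
-- again `ψ(t)|m|/2` times a pullback, of some `Θ'` independent of `m` (`exists_biAct_pullS`).
--
-- It remains to bound the `L¹`-norm of a pullback (`lintegral_pull_le`). After translation by the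
-- scalar `r` the integrand is `Θ'(ρ(g), (r/ρ(g)) g)`. It is supported in `ρ(g) ≥ a` and is
-- `O((r‖g‖)^{-k})` for every `k`, and `‖g‖^{-k}` is integrable there once `k` is large
-- (`lintegral_inv_norm_pow_lt_top`). The resulting bound `C |m| r^{-k}` gives all three assertions:
-- large `k` for `|m| > 1`, the smallest admissible `k` otherwise.

attribute [local instance] Matrix.linftyOpNormedRing Matrix.linftyOpNormedAlgebra in
lemma isOpenEmbedding_toVec : Topology.IsOpenEmbedding (toVec : GL (Fin 2) E → Vec E) :=
  Units.isOpenEmbedding_val (R := Matrix (Fin 2) (Fin 2) E)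

lemma continuous_toVec : Continuous (toVec : GL (Fin 2) E → Vec E) :=
  isOpenEmbedding_toVec.continuous

lemma range_toVec : Set.range (toVec : GL (Fin 2) E → Vec E) = unitSet E := by
  ext A
  exact ⟨fun ⟨g, hg⟩ => hg ▸ toVec_mem g, fun h => ⟨IsUnit.unit h, toVec_unit h⟩⟩

instance : LocallyCompactSpace (GL (Fin 2) E) := isOpenEmbedding_toVec.locallyCompactSpace

instance : SecondCountableTopology (GL (Fin 2) E) :=
  isOpenEmbedding_toVec.isEmbedding.secondCountableTopology

lemma isClosed_GL1 : IsClosed (GL1 E : Set (GL (Fin 2) E)) := by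
  have h : Continuous fun g : GL (Fin 2) E => absN (g : Matrix (Fin 2) (Fin 2) E).det :=
    ((Continuous.matrix_det Units.continuous_val).norm).pow _
  exact isClosed_eq h continuous_const

instance : LocallyCompactSpace (GL1 E) :=
  isClosed_GL1.isClosedEmbedding_subtypeVal.locallyCompactSpace

instance : SecondCountableTopology (GL1 E) :=
  inferInstanceAs (SecondCountableTopology (GL1 E : Set (GL (Fin 2) E)))

instance : BorelSpace (GL1 E) := Subtype.borelSpace _

end Topology

lemma absN_eq_one {x : E} : absN x = 1 ↔ ‖x‖ = 1 :=
  pow_eq_one_iff_of_nonneg (norm_nonneg _) Module.finrank_pos.ne'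

lemma mem_GL1 {g : GL (Fin 2) E} : g ∈ GL1 E ↔ ‖(g : Matrix (Fin 2) (Fin 2) E).det‖ = 1 :=
  absN_eq_one

/-! ### Unimodularity of `GL₂(E)¹` -/

/-- A matrix of `GL₂(E)¹` from its entries. -/
def mkGL1 (a b c d : E) (h : ‖a * d - b * c‖ = 1) : GL1 E :=
  ⟨GeneralLinearGroup.mkOfDetNeZero !![a, b; c, d] (by
    rw [Matrix.det_fin_two_of]; intro h0; rw [h0] at h; simp at h), by
    rw [mem_GL1]; simpa [GeneralLinearGroup.mkOfDetNeZero] using h⟩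

lemma coe_mkGL1 (a b c d : E) (h : ‖a * d - b * c‖ = 1) :
    ((mkGL1 a b c d h : GL (Fin 2) E) : Matrix (Fin 2) (Fin 2) E) = !![a, b; c, d] := rfl

lemma GL1_ext {g h : GL1 E} (H : ((g : GL (Fin 2) E) : Matrix (Fin 2) (Fin 2) E) =
    ((h : GL (Fin 2) E) : Matrix (Fin 2) (Fin 2) E)) : g = h :=
  Subtype.ext (Units.ext H)

lemma mkGL1_mul (a b c d : E) (h : ‖a * d - b * c‖ = 1) (a' b' c' d' : E)
    (h' : ‖a' * d' - b' * c'‖ = 1) :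
    mkGL1 a b c d h * mkGL1 a' b' c' d' h' = mkGL1 (a * a' + b * c') (a * b' + b * d')
      (c * a' + d * c') (c * b' + d * d') (by
        rw [← mul_one (1 : ℝ)]; nth_rewrite 1 [← h]; rw [← h', ← norm_mul]; congr 1; ring) := by
  apply GL1_ext
  rw [Subgroup.coe_mul, Units.val_mul, coe_mkGL1, coe_mkGL1, coe_mkGL1, Matrix.mul_fin_two]

lemma exists_eq_mkGL1 (g : GL1 E) : ∃ a b c d h, g = mkGL1 a b c d h := by
  have h0 := mem_GL1.1 g.2
  rw [Matrix.det_fin_two] at h0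
  exact ⟨_, _, _, _, h0, GL1_ext (by rw [coe_mkGL1]; exact Matrix.eta_fin_two _)⟩

/-- A positive character of `GL₂(E)¹` that is trivial on the centre is trivial. -/
lemma character_eq_one (χ : GL1 E →* NNReal)
    (hc : ∀ z (h : ‖z * z - 0 * 0‖ = 1), χ (mkGL1 z 0 0 z h) = 1) (g : GL1 E) : χ g = 1 := by
  have sq : ∀ x : NNReal, x * x = 1 → x = 1 := fun x hx => by
    rw [← pow_two] at hx; exact (pow_eq_one_iff_of_nonneg zero_le two_ne_zero).1 hx
  have canc : ∀ {x y : GL1 E} , χ x * χ y = χ y → χ x = 1 := fun {x y} h => by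
    have hy : χ y ≠ 0 := fun h0 => by
      have := map_one χ
      rw [← mul_inv_cancel y, map_mul, h0, zero_mul] at this
      exact zero_ne_one this
    exact mul_right_cancel₀ hy (h.trans (one_mul _).symm)
  -- Unipotents are commutators: conjugation by `diag(2, 1/2)` multiplies the entry by 4, and `4 ·
  -- (t/3) = t + t/3`.
  have hu : ∀ t (h : ‖(1 : E) * 1 - t * 0‖ = 1), χ (mkGL1 1 t 0 1 h) = 1 := by
    intro t h
    have h2 : ‖(2 : E) * 2⁻¹ - 0 * 0‖ = 1 := by simp
    have e : mkGL1 2 0 0 2⁻¹ h2 * mkGL1 1 (t / 3) 0 1 (by simp)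
        = mkGL1 1 t 0 1 h * (mkGL1 1 (t / 3) 0 1 (by simp) * mkGL1 2 0 0 2⁻¹ h2) := by
      simp only [mkGL1_mul]
      apply GL1_ext
      simp only [coe_mkGL1]
      congr 1
      ext i j
      fin_cases i <;> fin_cases j <;> simp <;> ring
    have := congrArg χ e
    rw [map_mul, map_mul, map_mul, mul_comm] at this
    rw [mul_comm (χ (mkGL1 1 (t / 3) 0 1 _))] at this
    refine canc (y := mkGL1 2 0 0 2⁻¹ h2 * mkGL1 1 (t / 3) 0 1 (by simp)) ?_
    rw [map_mul, ← this, mul_comm]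
  -- The square of an antidiagonal matrix is the scalar `b c`, and a positive number with square 1
  -- is 1.
  have hn : ∀ b c (h : ‖0 * 0 - b * c‖ = 1), χ (mkGL1 0 b c 0 h) = 1 := by
    intro b c h
    apply sq
    have hbc : ‖b‖ * ‖c‖ = 1 := by simpa using h
    rw [← map_mul, mkGL1_mul, ← hc (b * c) (by simp [hbc])]
    congr 1
    apply GL1_ext
    simp only [coe_mkGL1]
    congr 1
    ext i j
    fin_cases i <;> fin_cases j <;> simp [mul_comm]
  -- The big Bruhat cell: unipotent times antidiagonal times unipotent.
  have hc0 : ∀ a b c d h, c ≠ 0 → χ (mkGL1 a b c d h) = 1 := by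
    intro a b c d h hc0
    have e : mkGL1 a b c d h = mkGL1 1 (a / c) 0 1 (by simp) *
        (mkGL1 0 (-(a * d - b * c) / c) c 0 (by
          rw [← h]; congr 1; field_simp; ring) * mkGL1 1 (d / c) 0 1 (by simp)) := by
      simp only [mkGL1_mul]
      apply GL1_ext
      simp only [coe_mkGL1]
      congr 1
      ext i j
      fin_cases i <;> fin_cases j <;> simp <;> field_simp <;> ring
    rw [e, map_mul, map_mul, hu, hu, hn, one_mul, one_mul]
  obtain ⟨a, b, c, d, h, rfl⟩ := exists_eq_mkGL1 g
  by_cases hc1 : c = 0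
  · subst hc1
    have ha : a ≠ 0 := fun h0 => by simp [h0] at h
    have hw : ‖(0 : E) * 0 - 1 * 1‖ = 1 := by simp
    -- The Weyl element moves an upper triangular matrix into the big cell.
    have h2 : χ (mkGL1 0 1 1 0 hw * mkGL1 a b 0 d h) = 1 := by
      rw [mkGL1_mul]
      exact hc0 _ _ _ _ _ (by simpa using ha)
    rwa [map_mul, hn, one_mul] at h2
  · exact hc0 _ _ _ _ _ hc1

lemma mkGL1_center (z : E) (h : ‖z * z - 0 * 0‖ = 1) (g : GL1 E) :
    g * mkGL1 z 0 0 z h = mkGL1 z 0 0 z h * g := by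
  obtain ⟨a, b, c, d, h, rfl⟩ := exists_eq_mkGL1 g
  rw [mkGL1_mul, mkGL1_mul]
  apply GL1_ext
  simp only [coe_mkGL1]
  congr 1
  ext i j
  fin_cases i <;> fin_cases j <;> simp [mul_comm]

/-- The modular character is a positive character. It is trivial on the centre, where right
translation is left translation, so `character_eq_one` applies. -/
lemma isMulRightInvariant_of_haar (ν : Measure (GL1 E)) [ν.IsHaarMeasure] :
    ν.IsMulRightInvariant := by
  refine ⟨fun g => ?_⟩
  have h1 : Measure.modularCharacter g = 1 := by
    refine character_eq_one Measure.modularCharacter (fun z h => ?_) g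
    change Measure.modularCharacterFun _ = 1
    rw [Measure.modularCharacterFun_eq_haarScalarFactor ν]
    -- Stated for a variable `μ'` so that the equality of measures can be substituted together with
    -- the instances that depend on it.
    have key : ∀ (μ' : Measure (GL1 E)) [IsFiniteMeasureOnCompacts μ'] [μ'.IsMulLeftInvariant],
        μ' = ν → μ'.haarScalarFactor ν = 1 := by
      intro μ' _ _ h
      subst h
      exact Measure.haarScalarFactor_self _
    exact key _ (by simp_rw [mkGL1_center]; exact map_mul_left_eq_self ν _)
  have h2 := Measure.map_right_mul_eq_modularCharacterFun_smul ν g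
  rw [h2]
  change Measure.modularCharacter g • ν = ν
  rw [h1, one_smul]

/-! ### Matrix multiplication and determinant on `M₂(E)` -/

/-- Matrix multiplication as a continuous bilinear map. -/
def mulB (E : Type*) [RCLike E] : Vec E →L[ℝ] Vec E →L[ℝ] Vec E :=
  LinearMap.toContinuousBilinearMap (𝕜 := ℝ) (LinearMap.mk₂ ℝ
    (fun A B : Vec E => Matrix.of.symm (Matrix.of A * Matrix.of B))
    (fun A B C => congrArg Matrix.of.symm (add_mul (Matrix.of A) (Matrix.of B) (Matrix.of C)))
    (fun c A B => congrArg Matrix.of.symm (smul_mul_assoc c (Matrix.of A) (Matrix.of B)))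
    (fun A B C => congrArg Matrix.of.symm (mul_add (Matrix.of A) (Matrix.of B) (Matrix.of C)))
    (fun c A B => congrArg Matrix.of.symm (mul_smul_comm c (Matrix.of A) (Matrix.of B))))

/-- Left multiplication by a matrix. -/
def mulL (A : Vec E) : Vec E →L[ℝ] Vec E := mulB E A

lemma mulL_toVec (g h : GL (Fin 2) E) : mulL (toVec g) (toVec h) = toVec (g * h) := rfl

lemma mulL_toVec_mul (g h : GL (Fin 2) E) :
    mulL (toVec (g * h)) = (mulL (toVec g)).comp (mulL (toVec h)) := by
  ext1 A
  exact congrArg Matrix.of.symm (Matrix.mul_assoc (g : Matrix (Fin 2) (Fin 2) E) h (Matrix.of A))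

lemma mulL_toVec_one : mulL (toVec (1 : GL (Fin 2) E)) = ContinuousLinearMap.id ℝ (Vec E) := by
  ext1 A
  exact congrArg Matrix.of.symm (Matrix.one_mul (Matrix.of A))

/-- The determinant on `M₂(E)`. -/
def detV (A : Vec E) : E := A 0 0 * A 1 1 - A 0 1 * A 1 0

lemma detV_toVec (g : GL (Fin 2) E) : detV (toVec g) = (g : Matrix (Fin 2) (Fin 2) E).det := by
  rw [Matrix.det_fin_two]; rfl

lemma detV_ne_zero {A : Vec E} : A ∈ unitSet E ↔ detV A ≠ 0 := by
  simp [unitSet, Matrix.isUnit_iff_isUnit_det, isUnit_iff_ne_zero, Matrix.det_fin_two, detV]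

lemma norm_entry_le (A : Vec E) (i j : Fin 2) : ‖A i j‖ ≤ ‖A‖ :=
  (norm_le_pi_norm (A i) j).trans (norm_le_pi_norm A i)

lemma norm_detV_le (A : Vec E) : ‖detV A‖ ≤ 2 * ‖A‖ ^ 2 := by
  have h : ∀ i j k l, ‖A i j * A k l‖ ≤ ‖A‖ ^ 2 := fun i j k l => by
    rw [norm_mul, pow_two]
    exact mul_le_mul (norm_entry_le A i j) (norm_entry_le A k l) (norm_nonneg _) (norm_nonneg _)
  refine (norm_sub_le _ _).trans ?_
  linarith [h 0 0 1 1, h 0 1 1 0]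

/-- Cramer's rule: the adjugate of a 2 by 2 matrix has the same entries up to order and sign. -/
lemma norm_toVec_inv_le (g : GL (Fin 2) E) :
    ‖toVec g⁻¹‖ ≤ ‖toVec g‖ / ‖detV (toVec g)‖ := by
  have h0 := detV_ne_zero.1 (toVec_mem g)
  have hi : ((g⁻¹ : GL (Fin 2) E) : Matrix (Fin 2) (Fin 2) E) =
      (detV (toVec g))⁻¹ • !![toVec g 1 1, -toVec g 0 1; -toVec g 1 0, toVec g 0 0] := by
    rw [Matrix.coe_units_inv, Matrix.inv_def, Matrix.adjugate_fin_two, Ring.inverse_eq_inv',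
      detV_toVec]
    rfl
  have hj : toVec g⁻¹ = fun i j => (detV (toVec g))⁻¹ *
      !![toVec g 1 1, -toVec g 0 1; -toVec g 1 0, toVec g 0 0] i j := by
    funext i j
    exact congrFun (congrFun hi i) j
  rw [hj, pi_norm_le_iff_of_nonneg (by positivity)]
  intro i
  rw [pi_norm_le_iff_of_nonneg (by positivity)]
  intro j
  rw [norm_mul, norm_inv, div_eq_inv_mul]
  gcongr
  fin_cases i <;> fin_cases j <;> simp [norm_entry_le]

/-- `|det A|^{1/2}` for the usual absolute value. -/
def rho (A : Vec E) : ℝ := Real.sqrt ‖detV A‖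

lemma rho_pos (g : GL (Fin 2) E) : 0 < rho (toVec g) :=
  Real.sqrt_pos.2 (norm_pos_iff.2 (detV_ne_zero.1 (toVec_mem g)))

lemma rho_sq (A : Vec E) : rho A ^ 2 = ‖detV A‖ := Real.sq_sqrt (norm_nonneg _)

lemma continuous_rho : Continuous (rho : Vec E → ℝ) := by
  unfold rho detV
  fun_prop

lemma rho_le (A : Vec E) : rho A ≤ 2 * ‖A‖ := by
  refine abs_le_of_sq_le_sq' ?_ (by positivity) |>.2
  rw [rho_sq]
  nlinarith [norm_detV_le A, sq_nonneg ‖A‖]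

/-! ### Haar measure on `GL₂(E)` -/

section Haar

/-- The determinant is the factor by which `T` scales volume, and `T` maps the unit ball into the
ball of radius `‖T‖`. -/
lemma abs_det_le {V : Type*} [NormedAddCommGroup V] [NormedSpace ℝ V] [FiniteDimensional ℝ V]
    (T : V →L[ℝ] V) : |T.det| ≤ ‖T‖ ^ Module.finrank ℝ V := by
  borelize V
  have hb : (T : V →ₗ[ℝ] V) '' Metric.closedBall 0 1 ⊆ Metric.closedBall 0 ‖T‖ := by
    rintro _ ⟨x, hx, rfl⟩
    rw [mem_closedBall_zero_iff] at hx ⊢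
    exact (T.le_opNorm x).trans (mul_le_of_le_one_right (norm_nonneg _) hx)
  have h := measure_mono (μ := Measure.addHaar) hb
  rw [Measure.addHaar_image_linearMap, Measure.addHaar_closedBall' _ _ (norm_nonneg _)] at h
  have h0 : Measure.addHaar (Metric.closedBall (0 : V) 1) ≠ 0 :=
    (Metric.measure_closedBall_pos _ _ one_pos).ne'
  have h1 : Measure.addHaar (Metric.closedBall (0 : V) 1) ≠ ⊤ := measure_closedBall_lt_top.ne
  rw [ENNReal.mul_le_mul_iff_left h0 h1] at h
  exact (ENNReal.ofReal_le_ofReal_iff (by positivity)).1 h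

/-- The factor by which left multiplication by `g` changes Lebesgue measure on `M₂(E)`. -/
def leftScale (g : GL (Fin 2) E) : ℝ := |(mulL (toVec g)).det|

lemma leftScale_mul (g h : GL (Fin 2) E) : leftScale (g * h) = leftScale g * leftScale h := by
  rw [leftScale, mulL_toVec_mul, leftScale, leftScale, ← abs_mul]
  congr 1
  exact LinearMap.det_comp _ _

lemma leftScale_mul_inv (g : GL (Fin 2) E) : leftScale g * leftScale g⁻¹ = 1 := by
  rw [← leftScale_mul, mul_inv_cancel, leftScale, mulL_toVec_one]
  simp [ContinuousLinearMap.det]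

lemma leftScale_pos (g : GL (Fin 2) E) : 0 < leftScale g :=
  (abs_nonneg _).lt_of_ne' (left_ne_zero_of_mul_eq_one (leftScale_mul_inv g))

lemma leftScale_inv (g : GL (Fin 2) E) : leftScale g⁻¹ = (leftScale g)⁻¹ :=
  eq_inv_of_mul_eq_one_right (leftScale_mul_inv g)

lemma continuous_leftScale : Continuous (leftScale : GL (Fin 2) E → ℝ) :=
  (ContinuousLinearMap.continuous_det.comp ((mulB E).continuous.comp continuous_toVec)).abs

/-- The Borel structure on `M₂(E)`. -/
@[reducible] def borelVec : MeasurableSpace (Vec E) := borel _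

attribute [local instance] borelVec

lemma borelSpace_vec : BorelSpace (Vec E) := ⟨rfl⟩

attribute [local instance] borelSpace_vec

lemma measurableEmbedding_toVec : MeasurableEmbedding (toVec : GL (Fin 2) E → Vec E) :=
  isOpenEmbedding_toVec.measurableEmbedding

/-- Lebesgue measure on the open subset `GL₂(E)` of `M₂(E)`. -/
def lebGL : Measure (GL (Fin 2) E) := Measure.comap toVec (Measure.addHaar : Measure (Vec E))

lemma lebGL_apply (s : Set (GL (Fin 2) E)) :
    lebGL s = (Measure.addHaar : Measure (Vec E)) (toVec '' s) :=
  measurableEmbedding_toVec.comap_apply _ _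

lemma map_mul_left_lebGL (g : GL (Fin 2) E) :
    lebGL.map (g * ·) = ENNReal.ofReal (leftScale g)⁻¹ • lebGL := by
  ext s hs
  rw [Measure.map_apply (measurable_const_mul g) hs, Measure.smul_apply, lebGL_apply, lebGL_apply,
    smul_eq_mul]
  have h : toVec '' ((g * ·) ⁻¹' s) = (mulL (toVec g⁻¹) : Vec E →ₗ[ℝ] Vec E) '' (toVec '' s) := by
    ext A
    constructor
    · rintro ⟨x, hx, rfl⟩
      exact ⟨_, ⟨_, hx, rfl⟩, by simp [mulL_toVec]⟩
    · rintro ⟨_, ⟨x, hx, rfl⟩, rfl⟩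
      exact ⟨g⁻¹ * x, by simpa using hx, rfl⟩
  rw [h, Measure.addHaar_image_linearMap, ← leftScale_inv]
  rfl

instance : IsFiniteMeasureOnCompacts (lebGL (E := E)) := ⟨fun K hK => by
  rw [lebGL_apply]
  exact (hK.image continuous_toVec).measure_lt_top⟩

lemma continuous_inv_leftScale : Continuous fun g : GL (Fin 2) E => (leftScale g)⁻¹ :=
  continuous_leftScale.inv₀ fun g => (leftScale_pos g).ne'

/-- A Haar measure on `GL₂(E)`. -/
def haarGL : Measure (GL (Fin 2) E) := lebGL.withDensity fun g => ENNReal.ofReal (leftScale g)⁻¹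

lemma measurable_density : Measurable fun g : GL (Fin 2) E => ENNReal.ofReal (leftScale g)⁻¹ :=
  continuous_inv_leftScale.measurable.ennreal_ofReal

/-- Left translation scales Lebesgue measure by `leftScale g`; as `leftScale` is multiplicative, the
density compensates exactly. -/
instance : (haarGL (E := E)).IsMulLeftInvariant := ⟨fun g => by
  have hd := measurable_density (E := E)
  ext s hs
  rw [Measure.map_apply (measurable_const_mul g) hs, haarGL,
    withDensity_apply _ (measurable_const_mul g hs), withDensity_apply _ hs,
    ← lintegral_indicator (measurable_const_mul g hs), ← lintegral_indicator hs]
  have h1 : ∀ x, ((g * ·) ⁻¹' s).indicator (fun g => ENNReal.ofReal (leftScale g)⁻¹) x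
      = ENNReal.ofReal (leftScale g) *
        s.indicator (fun g => ENNReal.ofReal (leftScale g)⁻¹) (g * x) := by
    intro x
    by_cases hx : g * x ∈ s
    · rw [Set.indicator_of_mem (by exact hx), Set.indicator_of_mem hx, leftScale_mul,
        ← ENNReal.ofReal_mul (leftScale_pos g).le, mul_inv, ← mul_assoc,
        mul_inv_cancel₀ (leftScale_pos g).ne', one_mul]
    · rw [Set.indicator_of_notMem (by exact hx), Set.indicator_of_notMem hx, mul_zero]
  simp_rw [h1]
  have hm : Measurable (s.indicator fun g => ENNReal.ofReal (leftScale g)⁻¹) := hd.indicator hs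
  rw [lintegral_const_mul _ (show Measurable fun x => s.indicator _ (g * x) from
    hm.comp (measurable_const_mul g)),
    ← lintegral_map hm (measurable_const_mul g), map_mul_left_lebGL, lintegral_smul_measure,
    smul_eq_mul, ← mul_assoc, ← ENNReal.ofReal_mul (leftScale_pos g).le,
    mul_inv_cancel₀ (leftScale_pos g).ne', ENNReal.ofReal_one, one_mul]⟩

instance : IsLocallyFiniteMeasure (haarGL (E := E)) :=
  haveI : IsLocallyFiniteMeasure (lebGL (E := E)) :=
    isLocallyFiniteMeasure_of_isFiniteMeasureOnCompacts
  IsLocallyFiniteMeasure.withDensity_ofReal continuous_inv_leftScale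

lemma haarGL_ne_zero : haarGL (E := E) ≠ 0 := by
  intro h
  have h1 : lebGL (E := E) = 0 := by
    rw [haarGL, withDensity_eq_zero_iff measurable_density.aemeasurable] at h
    have h2 : ∀ᵐ g ∂(lebGL (E := E)), False := h.mono fun g hg => by
      simp [leftScale_pos g] at hg
    simpa using h2
  have h2 := lebGL_apply (Set.univ : Set (GL (Fin 2) E))
  rw [h1, Set.image_univ, range_toVec] at h2
  exact (isOpen_unitSet.measure_pos _ ⟨_, toVec_mem 1⟩).ne h2

/-- Let `n = dim_ℝ M₂(E)`. Where `ρ ≥ a`, Cramer's rule gives `‖g⁻¹‖ ≤ ‖g‖/a²`, so the Haar density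
is `O(‖g‖^n)`, and `‖g‖ ≥ a/2`. The integrand against Lebesgue measure is thus `O((1 +
‖g‖)^{-(n+1)})`, which is integrable in dimension `n`; the `j` surplus powers are bounded by a
constant. -/
lemma lintegral_haarGL_lt_top (j : ℕ) {a : ℝ} (ha : 0 < a) :
    ∫⁻ g in {g : GL (Fin 2) E | a ≤ rho (toVec g)},
      ENNReal.ofReal ((‖toVec g‖ ^ (2 * Module.finrank ℝ (Vec E) + 1 + j))⁻¹) ∂haarGL < ⊤ := by
  set n := Module.finrank ℝ (Vec E) with hn
  set c := ‖mulB E‖ with hc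
  have hms : MeasurableSet {g : GL (Fin 2) E | a ≤ rho (toVec g)} :=
    (isClosed_le continuous_const (continuous_rho.comp continuous_toVec)).measurableSet
  have hmf : Measurable fun g : GL (Fin 2) E =>
      ENNReal.ofReal ((‖toVec g‖ ^ (2 * n + 1 + j))⁻¹) :=
    ((continuous_toVec.norm.pow _).measurable.inv).ennreal_ofReal
  set C : ℝ := (c / a ^ 2) ^ n * ((1 + 2 / a) ^ (n + 1) * (2 / a) ^ j) with hC
  have hbound : ∀ g ∈ {g : GL (Fin 2) E | a ≤ rho (toVec g)},
      ((fun g : GL (Fin 2) E => ENNReal.ofReal (leftScale g)⁻¹) *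
        fun g : GL (Fin 2) E => ENNReal.ofReal ((‖toVec g‖ ^ (2 * n + 1 + j))⁻¹)) g
      ≤ ENNReal.ofReal (C * (1 + ‖toVec g‖) ^ (-((n : ℝ) + 1))) := by
    intro g hg
    have hg' : a ≤ rho (toVec g) := hg
    rw [Pi.mul_apply, ← ENNReal.ofReal_mul (inv_nonneg.2 (leftScale_pos g).le)]
    apply ENNReal.ofReal_le_ofReal
    set x := ‖toVec g‖ with hx
    have hxa : a / 2 ≤ x := by linarith [rho_le (toVec g)]
    have hx0 : 0 < x := by linarith [half_pos ha]
    have h1 : ‖mulL (toVec g⁻¹)‖ ≤ c / a ^ 2 * x := by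
      refine ((mulB E).le_opNorm _).trans ?_
      have h2 : ‖toVec g⁻¹‖ ≤ x / a ^ 2 := by
        refine (norm_toVec_inv_le g).trans ?_
        rw [← rho_sq]
        gcongr
      calc c * ‖toVec g⁻¹‖ ≤ c * (x / a ^ 2) := by gcongr
        _ = c / a ^ 2 * x := by ring
    have h3 : (leftScale g)⁻¹ ≤ (c / a ^ 2) ^ n * x ^ n := by
      rw [← leftScale_inv, ← mul_pow]
      exact (abs_det_le _).trans (by gcongr)
    have h4 : (1 + x) ≤ (1 + 2 / a) * x := by
      have : 1 ≤ 2 / a * x := by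
        rw [div_mul_eq_mul_div, le_div_iff₀ ha]; linarith
      linarith
    have h5 : x⁻¹ ≤ 2 / a := by
      rw [inv_le_comm₀ hx0 (by positivity), inv_div]; exact hxa
    have h6 : x⁻¹ ≤ (1 + 2 / a) * (1 + x)⁻¹ := by
      rw [inv_le_iff_one_le_mul₀ hx0, mul_assoc, mul_comm _ x, ← mul_assoc]
      rw [← div_eq_mul_inv, le_div_iff₀ (by positivity), one_mul]
      exact h4
    have h7 : (1 + x) ^ (-((n : ℝ) + 1)) = ((1 + x)⁻¹) ^ (n + 1) := by
      rw [Real.rpow_neg (by positivity), inv_pow]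
      norm_cast
    rw [h7]
    calc (leftScale g)⁻¹ * (x ^ (2 * n + 1 + j))⁻¹
        ≤ ((c / a ^ 2) ^ n * x ^ n) * (x ^ (2 * n + 1 + j))⁻¹ := by gcongr
      _ = (c / a ^ 2) ^ n * ((x⁻¹) ^ (n + 1) * (x⁻¹) ^ j) := by
        rw [mul_assoc]
        congr 1
        rw [inv_pow, inv_pow, ← mul_inv, ← pow_add, show 2 * n + 1 + j = n + (n + 1 + j) by ring,
          pow_add x n]
        field_simp
      _ ≤ (c / a ^ 2) ^ n * (((1 + 2 / a) * (1 + x)⁻¹) ^ (n + 1) * (2 / a) ^ j) := by gcongr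
      _ = C * (1 + x)⁻¹ ^ (n + 1) := by rw [hC, mul_pow]; ring
  rw [haarGL, setLIntegral_withDensity_eq_setLIntegral_mul _ measurable_density hmf hms]
  have hint : Integrable (fun A : Vec E => C * (1 + ‖A‖) ^ (-((n : ℝ) + 1))) Measure.addHaar :=
    (integrable_one_add_norm (by rw [hn]; linarith)).const_mul C
  calc _ ≤ ∫⁻ g in {g : GL (Fin 2) E | a ≤ rho (toVec g)},
        ENNReal.ofReal (C * (1 + ‖toVec g‖) ^ (-((n : ℝ) + 1))) ∂lebGL :=
        setLIntegral_mono' hms hbound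
    _ ≤ ∫⁻ g : GL (Fin 2) E,
        ENNReal.ofReal (C * (1 + ‖toVec g‖) ^ (-((n : ℝ) + 1))) ∂lebGL :=
        setLIntegral_le_lintegral _ _
    _ = ∫⁻ A : Vec E, ENNReal.ofReal (C * (1 + ‖A‖) ^ (-((n : ℝ) + 1))) ∂(lebGL.map toVec) :=
        (measurableEmbedding_toVec.lintegral_map
          fun A => ENNReal.ofReal (C * (1 + ‖A‖) ^ (-((n : ℝ) + 1)))).symm
    _ ≤ ∫⁻ A : Vec E, ENNReal.ofReal (C * (1 + ‖A‖) ^ (-((n : ℝ) + 1))) ∂Measure.addHaar := by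
        rw [lebGL, measurableEmbedding_toVec.map_comap]
        exact setLIntegral_le_lintegral _ _
    _ < ⊤ := hint.lintegral_lt_top

/-- By uniqueness of Haar measure, `haarGL` is a nonzero multiple of `μ`. -/
theorem lintegral_inv_norm_pow_lt_top (μ : Measure (GL (Fin 2) E)) [μ.IsHaarMeasure] (j : ℕ)
    {a : ℝ} (ha : 0 < a) :
    ∫⁻ g in {g : GL (Fin 2) E | a ≤ rho (toVec g)},
      ENNReal.ofReal ((‖toVec g‖ ^ (2 * Module.finrank ℝ (Vec E) + 1 + j))⁻¹) ∂μ < ⊤ := by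
  have h := lintegral_haarGL_lt_top (E := E) j ha
  have hu := Measure.isMulLeftInvariant_eq_smul (haarGL (E := E)) μ
  set c := Measure.haarScalarFactor (haarGL (E := E)) μ
  have hc : c ≠ 0 := fun h0 => haarGL_ne_zero (by rw [hu, h0, zero_smul])
  rw [hu, Measure.restrict_smul, lintegral_smul_measure] at h
  refine lt_top_iff_ne_top.2 fun htop => h.ne ?_
  rw [htop]
  exact ENNReal.mul_top (by exact_mod_cast hc)

end Haar

/-! ### Schwartz functions -/

section Schwartz

open scoped SchwartzMap

variable {P V V' F : Type*} [NormedAddCommGroup P] [NormedSpace ℝ P] [NormedAddCommGroup V]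
  [NormedSpace ℝ V] [NormedAddCommGroup V'] [NormedSpace ℝ V']
  [NormedAddCommGroup F] [NormedSpace ℝ F]

lemma norm_iteratedFDeriv_comp_clm_le {f : V → F} (hf : ContDiff ℝ ∞ f) (L : P →L[ℝ] V) (n : ℕ)
    (x : P) : ‖iteratedFDeriv ℝ n (f ∘ L) x‖ ≤ ‖iteratedFDeriv ℝ n f (L x)‖ * ‖L‖ ^ n := by
  rw [L.iteratedFDeriv_comp_right hf x (by exact_mod_cast le_top)]
  refine (ContinuousMultilinearMap.norm_compContinuousLinearMap_le _ _).trans ?_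
  simp

lemma exists_one_add_pow_mul_le (f : 𝓢(V, F)) (k n : ℕ) :
    ∃ C : ℝ, 0 ≤ C ∧ ∀ x, (1 + ‖x‖) ^ k * ‖iteratedFDeriv ℝ n f x‖ ≤ C := by
  have h := fun x => SchwartzMap.one_add_le_sup_seminorm_apply (𝕜 := ℝ) (m := (k, n)) le_rfl le_rfl f x
  exact ⟨_, le_trans (by positivity) (h 0), h⟩

/-- The tensor product of two Schwartz functions. -/
lemma exists_schwartz_prod (f : 𝓢(V, ℝ)) (g : 𝓢(V', ℂ)) :
    ∃ S : 𝓢(V × V', ℂ), ∀ p, S p = f p.1 • g p.2 := by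
  have hf : ContDiff ℝ ∞ (f ∘ ContinuousLinearMap.fst ℝ V V') :=
    (f.smooth ⊤).comp (ContinuousLinearMap.contDiff _)
  have hg : ContDiff ℝ ∞ (g ∘ ContinuousLinearMap.snd ℝ V V') :=
    (g.smooth ⊤).comp (ContinuousLinearMap.contDiff _)
  refine ⟨⟨fun p => (f ∘ ContinuousLinearMap.fst ℝ V V') p •
    (g ∘ ContinuousLinearMap.snd ℝ V V') p, hf.smul hg, fun k n => ?_⟩, fun p => rfl⟩
  choose C hC0 hC using fun i => exists_one_add_pow_mul_le f k i
  choose D hD0 hD using fun i => exists_one_add_pow_mul_le g k i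
  refine ⟨∑ i ∈ Finset.range (n + 1), n.choose i * (C i * D (n - i)), fun p => ?_⟩
  have hp : ‖p‖ ^ k ≤ (1 + ‖p.1‖) ^ k * (1 + ‖p.2‖) ^ k := by
    rw [← mul_pow]
    gcongr
    rw [Prod.norm_def, max_le_iff]
    constructor <;> nlinarith [norm_nonneg p.1, norm_nonneg p.2,
      mul_nonneg (norm_nonneg p.1) (norm_nonneg p.2)]
  refine (mul_le_mul hp (norm_iteratedFDeriv_smul_le hf hg p (n := n)
    (by exact_mod_cast le_top)) (norm_nonneg _) (by positivity)).trans ?_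
  rw [Finset.mul_sum]
  refine Finset.sum_le_sum fun i _ => ?_
  have h1 := (norm_iteratedFDeriv_comp_clm_le (f.smooth ⊤) (ContinuousLinearMap.fst ℝ V V') i p).trans
    (mul_le_of_le_one_right (norm_nonneg _)
      (pow_le_one₀ (norm_nonneg _) (ContinuousLinearMap.norm_fst_le ℝ V V')))
  have h2 := (norm_iteratedFDeriv_comp_clm_le (g.smooth ⊤) (ContinuousLinearMap.snd ℝ V V')
    (n - i) p).trans
    (mul_le_of_le_one_right (norm_nonneg _)
      (pow_le_one₀ (norm_nonneg _) (ContinuousLinearMap.norm_snd_le ℝ V V')))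
  calc (1 + ‖p.1‖) ^ k * (1 + ‖p.2‖) ^ k * (n.choose i *
        ‖iteratedFDeriv ℝ i (f ∘ ContinuousLinearMap.fst ℝ V V') p‖ *
        ‖iteratedFDeriv ℝ (n - i) (g ∘ ContinuousLinearMap.snd ℝ V V') p‖)
      ≤ (1 + ‖p.1‖) ^ k * (1 + ‖p.2‖) ^ k * (n.choose i *
        ‖iteratedFDeriv ℝ i f p.1‖ * ‖iteratedFDeriv ℝ (n - i) g p.2‖) := by gcongr <;> assumption
    _ = n.choose i * (((1 + ‖p.1‖) ^ k * ‖iteratedFDeriv ℝ i f p.1‖) *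
        ((1 + ‖p.2‖) ^ k * ‖iteratedFDeriv ℝ (n - i) g p.2‖)) := by ring
    _ ≤ n.choose i * (C i * D (n - i)) := by
      gcongr
      · exact hC0 i
      · exact hC i p.1
      · exact hD _ p.2

/-- Combine `y^N ≤ N! e^y` at `y = 2c(1+s)` with `-cs² ≤ 3c - 2c(1+s)`, which is `c(s-1)² ≥ 0`. -/
lemma one_add_pow_mul_exp_neg_le {c : ℝ} (hc : 0 < c) (N : ℕ) {s : ℝ} (hs : 0 ≤ s) :
    (1 + s) ^ N * Real.exp (-(c * s ^ 2)) ≤ N.factorial * Real.exp (3 * c) / (2 * c) ^ N := by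
  have h1 := Real.pow_div_factorial_le_exp (2 * c * (1 + s)) (by positivity) N
  rw [div_le_iff₀ (by positivity), mul_pow] at h1
  have h2 : Real.exp (-(c * s ^ 2)) ≤ Real.exp (3 * c) * Real.exp (-(2 * c * (1 + s))) := by
    rw [← Real.exp_add, Real.exp_le_exp]
    nlinarith [mul_nonneg hc.le (sq_nonneg (s - 1))]
  rw [le_div_iff₀ (by positivity)]
  calc (1 + s) ^ N * Real.exp (-(c * s ^ 2)) * (2 * c) ^ N
      = ((2 * c) ^ N * (1 + s) ^ N) * Real.exp (-(c * s ^ 2)) := by ring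
    _ ≤ (Real.exp (2 * c * (1 + s)) * N.factorial) *
        (Real.exp (3 * c) * Real.exp (-(2 * c * (1 + s)))) := by gcongr
    _ = N.factorial * Real.exp (3 * c) *
        (Real.exp (2 * c * (1 + s)) * Real.exp (-(2 * c * (1 + s)))) := by ring
    _ = N.factorial * Real.exp (3 * c) := by rw [← Real.exp_add]; simp

/-- The Gaussian of a positive definite quadratic form is a Schwartz function. -/
lemma exists_schwartz_gaussian (b : V →L[ℝ] V →L[ℝ] ℝ) {c : ℝ} (hc : 0 < c)
    (hb : ∀ x, c * ‖x‖ ^ 2 ≤ b x x) : ∃ S : 𝓢(V, ℝ), ∀ x, S x = Real.exp (-(b x x)) := by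
  set q : V → ℝ := fun x => -(b x x) with hq
  have hqs : ContDiff ℝ ∞ q := (b.contDiff.clm_apply contDiff_id).neg
  set T : V →L[ℝ] V →L[ℝ] ℝ := -(b + b.flip) with hT
  have hfd : fderiv ℝ q = T := by
    funext x
    refine (HasFDerivAt.fderiv ?_)
    have := ((b.hasFDerivAt (x := x)).clm_apply (hasFDerivAt_id x)).neg
    refine this.congr_fderiv ?_
    ext v
    simp [hT]
  set K := 1 + ‖T‖ with hK
  have hK1 : 1 ≤ K := le_add_of_nonneg_right (ContinuousLinearMap.opNorm_nonneg T)
  -- The first derivative of a quadratic form is linear, the second constant, the others zero. The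
  -- bound has the shape `D ^ i` that the Faà di Bruno estimate `norm_iteratedFDeriv_comp_le`
  -- requires.
  have hqb : ∀ (x : V) (i : ℕ), 1 ≤ i → ‖iteratedFDeriv ℝ i q x‖ ≤ (K * (1 + ‖x‖)) ^ i := by
    intro x i hi
    obtain ⟨i, rfl⟩ : ∃ j, i = j + 1 := ⟨i - 1, by omega⟩
    have hone : 1 ≤ K * (1 + ‖x‖) := by nlinarith [norm_nonneg x]
    rw [← norm_iteratedFDeriv_fderiv, hfd]
    rcases i with _ | i
    · rw [norm_iteratedFDeriv_zero, pow_one]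
      refine (T.le_opNorm x).trans ?_
      gcongr <;> simp [hK]
    · rw [← norm_iteratedFDeriv_fderiv, show fderiv ℝ T = fun _ => T from funext fun x => T.fderiv]
      rcases i with _ | i
      · rw [norm_iteratedFDeriv_zero]
        refine le_trans ?_ (le_self_pow₀ hone two_ne_zero)
        nlinarith [norm_nonneg x]
      · rw [iteratedFDeriv_succ_const]
        simp only [Pi.zero_apply, norm_zero]
        positivity
  refine ⟨⟨fun x => Real.exp (q x), Real.contDiff_exp.comp hqs, fun k n => ?_⟩, fun x => rfl⟩
  refine ⟨n.factorial * K ^ n * ((k + n).factorial * Real.exp (3 * c) / (2 * c) ^ (k + n)),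
    fun x => ?_⟩
  have h1 := norm_iteratedFDeriv_comp_le (g := Real.exp) (f := q) (n := n) Real.contDiff_exp hqs
    (by exact_mod_cast le_top) x (C := Real.exp (q x)) (D := K * (1 + ‖x‖))
    (fun i _ => by
      rw [norm_iteratedFDeriv_eq_norm_iteratedDeriv, iteratedDeriv_eq_iterate, Real.iter_deriv_exp,
        Real.norm_of_nonneg (Real.exp_pos _).le])
    (fun i hi _ => hqb x i hi)
  have h2 : Real.exp (q x) ≤ Real.exp (-(c * ‖x‖ ^ 2)) := Real.exp_le_exp.2 (neg_le_neg (hb x))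
  calc ‖x‖ ^ k * ‖iteratedFDeriv ℝ n (Real.exp ∘ q) x‖
      ≤ (1 + ‖x‖) ^ k * (n.factorial * Real.exp (-(c * ‖x‖ ^ 2)) * (K * (1 + ‖x‖)) ^ n) := by
        gcongr
        · linarith
        · exact h1.trans (by gcongr)
    _ = n.factorial * K ^ n * ((1 + ‖x‖) ^ (k + n) * Real.exp (-(c * ‖x‖ ^ 2))) := by
        rw [mul_pow, pow_add]; ring
    _ ≤ _ := by
        gcongr
        exact one_add_pow_mul_exp_neg_le hc _ (norm_nonneg x)

/-- The derivative of a Schwartz function along a linear vector field. -/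
def schwartzDeriv (w : P →L[ℝ] P) : 𝓢(P, ℂ) →L[ℝ] 𝓢(P, ℂ) :=
  (SchwartzMap.bilinLeftCLM (ContinuousLinearMap.id ℝ (P →L[ℝ] ℂ)) w.hasTemperateGrowth).comp
    (SchwartzMap.fderivCLM ℝ P ℂ)

lemma schwartzDeriv_apply (w : P →L[ℝ] P) (f : 𝓢(P, ℂ)) (p : P) :
    schwartzDeriv w f p = fderiv ℝ f p (w p) := rfl

/-- The average of the composites of a Schwartz function with a bounded family of linear maps that
are uniformly bounded below. -/
lemma exists_schwartz_integral {α : Type*} [TopologicalSpace α] [MeasurableSpace α] [BorelSpace α]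
    [SecondCountableTopology α] (κ : Measure α) [IsFiniteMeasure κ] (S : 𝓢(V, ℂ))
    (L : α → P →L[ℝ] V) (hL : Continuous L) {M : ℝ} (hM : 0 ≤ M) (h1 : ∀ᵐ a ∂κ, ‖L a‖ ≤ M)
    (h2 : ∀ᵐ a ∂κ, ∀ p, ‖p‖ ≤ M * ‖L a p‖) :
    ∃ Θ : 𝓢(P, ℂ), ∀ p, Θ p = ∫ a, S (L a p) ∂κ := by
  set G : ∀ n : ℕ, α → P → ContinuousMultilinearMap ℝ (fun _ : Fin n => P) ℂ :=
    fun n a => iteratedFDeriv ℝ n (S ∘ L a) with hG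
  have hsm : ∀ a, ContDiff ℝ ∞ (S ∘ L a) := fun a => (S.smooth ⊤).comp (L a).contDiff
  have hGeq : ∀ n a p, G n a p
      = (iteratedFDeriv ℝ n S (L a p)).compContinuousLinearMap fun _ => L a := fun n a p =>
    (L a).iteratedFDeriv_comp_right (S.smooth ⊤) p (by exact_mod_cast le_top)
  have hGc : ∀ n p, Continuous fun a => G n a p := by
    intro n p
    have e : (fun a => G n a p) = fun a =>
        ContinuousMultilinearMap.compContinuousLinearMapContinuousMultilinear ℝ
          (fun _ : Fin n => P) (fun _ : Fin n => V) ℂ (fun _ => L a)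
          (iteratedFDeriv ℝ n S (L a p)) := funext fun a => hGeq n a p
    rw [e]
    refine Continuous.clm_apply ?_ ?_
    · exact (ContinuousMultilinearMap.cont _).comp (continuous_pi fun _ => hL)
    · exact ((S.smooth ⊤).continuous_iteratedFDeriv (by exact_mod_cast le_top)).comp
        (hL.clm_apply continuous_const)
  have hGm : ∀ n p, AEStronglyMeasurable (fun a => G n a p) κ := fun n p =>
    (hGc n p).aestronglyMeasurable
  -- The lower bound on `L a` turns decay in `L a p` into decay in `p`; the upper bound pays for the
  -- `n` derivatives. Both are uniform in `a`.
  have hdec : ∀ k n, ∃ C : ℝ, 0 ≤ C ∧ ∀ᵐ a ∂κ, ∀ p, ‖p‖ ^ k * ‖G n a p‖ ≤ C := by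
    intro k n
    obtain ⟨C, hC0, hC⟩ := S.decay k n
    refine ⟨M ^ k * C * M ^ n, by positivity, ?_⟩
    filter_upwards [h1, h2] with a ha1 ha2 p
    calc ‖p‖ ^ k * ‖G n a p‖
        ≤ (M * ‖L a p‖) ^ k * (‖iteratedFDeriv ℝ n S (L a p)‖ * M ^ n) := by
          gcongr
          · exact ha2 p
          · exact (norm_iteratedFDeriv_comp_clm_le (S.smooth ⊤) (L a) n p).trans (by gcongr)
      _ = M ^ k * (‖L a p‖ ^ k * ‖iteratedFDeriv ℝ n S (L a p)‖) * M ^ n := by ring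
      _ ≤ M ^ k * C * M ^ n := by
        gcongr
        exact hC _
  have hGi : ∀ n p, Integrable (fun a => G n a p) κ := by
    intro n p
    obtain ⟨C, -, hC⟩ := hdec 0 n
    refine Integrable.of_bound (hGm n p) C ?_
    filter_upwards [hC] with a ha
    simpa using ha p
  have hfd : ∀ n a p, HasFDerivAt (G n a)
      (continuousMultilinearCurryLeftEquiv ℝ (fun _ => P) ℂ (G (n + 1) a p)) p := by
    intro n a p
    have hd : DifferentiableAt ℝ (G n a) p :=
      ((hsm a).differentiable_iteratedFDeriv (by exact_mod_cast ENat.natCast_lt_top n)) p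
    have := hd.hasFDerivAt
    rwa [show fderiv ℝ (G n a) p = _ from congrFun fderiv_iteratedFDeriv p] at this
  -- Differentiation under the integral sign, dominated by the constant of `hdec 0 (n + 1)`, which
  -- is integrable since `κ` is finite.
  have hint : ∀ n p, HasFDerivAt (fun p => ∫ a, G n a p ∂κ)
      (continuousMultilinearCurryLeftEquiv ℝ (fun _ => P) ℂ (∫ a, G (n + 1) a p ∂κ)) p := by
    intro n p
    obtain ⟨C, -, hC⟩ := hdec 0 (n + 1)
    have := hasFDerivAt_integral_of_dominated_of_fderiv_le (𝕜 := ℝ) (μ := κ)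
      (F := fun p a => G n a p)
      (F' := fun p a => continuousMultilinearCurryLeftEquiv ℝ (fun _ => P) ℂ (G (n + 1) a p))
      (bound := fun _ => C) (x₀ := p) Filter.univ_mem
      (Filter.Eventually.of_forall fun p => hGm n p) (hGi n p)
      ((LinearIsometryEquiv.continuous _).comp_aestronglyMeasurable (hGm (n + 1) p))
      (by
        filter_upwards [hC] with a ha x _
        rw [LinearIsometryEquiv.norm_map]
        simpa using ha x)
      (integrable_const C)
      (Filter.Eventually.of_forall fun a x _ => hfd n a x)
    refine this.congr_fderiv ?_
    exact ContinuousLinearEquiv.integral_comp_comm (𝕜 := ℝ)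
      (E := ContinuousMultilinearMap ℝ (fun _ : Fin (n + 1) => P) ℂ)
      (F := P →L[ℝ] ContinuousMultilinearMap ℝ (fun _ : Fin n => P) ℂ)
      (continuousMultilinearCurryLeftEquiv ℝ (fun _ : Fin (n + 1) => P) ℂ).toContinuousLinearEquiv
      (μ := κ) fun a => G (n + 1) a p
  have hit : ∀ n, iteratedFDeriv ℝ n (fun p => ∫ a, S (L a p) ∂κ) = fun p => ∫ a, G n a p ∂κ := by
    intro n
    induction n with
    | zero =>
      rw [iteratedFDeriv_zero_eq_comp]
      funext p
      have := (continuousMultilinearCurryFin0 ℝ P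
        ℂ).symm.toContinuousLinearEquiv.integral_comp_comm (μ := κ) fun a => S (L a p)
      refine Eq.trans this.symm ?_
      simp only [hG, iteratedFDeriv_zero_eq_comp]
      rfl
    | succ n ih =>
      rw [iteratedFDeriv_succ_eq_comp_left, ih]
      funext p
      rw [Function.comp_apply, (hint n p).fderiv, LinearIsometryEquiv.symm_apply_apply]
  refine ⟨⟨fun p => ∫ a, S (L a p) ∂κ, ?_, fun k n => ?_⟩, fun p => rfl⟩
  · refine contDiff_of_differentiable_iteratedFDeriv fun n _ => ?_
    rw [hit n]
    exact fun p => (hint n p).differentiableAt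
  · obtain ⟨C, hC0, hC⟩ := hdec k n
    refine ⟨C * κ.real Set.univ, fun p => ?_⟩
    rw [hit n, ← Real.norm_of_nonneg (pow_nonneg (norm_nonneg p) k), ← norm_smul, ← integral_smul]
    refine norm_integral_le_of_norm_le_const ?_
    filter_upwards [hC] with a ha
    rw [norm_smul, Real.norm_of_nonneg (pow_nonneg (norm_nonneg p) k)]
    exact ha p

end Schwartz

/-! ### Functions on `GL₂(E)` from Schwartz functions on `ℝ × M₂(E)` -/

section Pull

open scoped SchwartzMap

/-- The matrix entries as linear forms. -/
def entryL (i j : Fin 2) : Vec E →L[ℝ] E :=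
  (ContinuousLinearMap.proj (R := ℝ) (φ := fun _ : Fin 2 => E) j).comp
    (ContinuousLinearMap.proj (R := ℝ) (φ := fun _ : Fin 2 => Fin 2 → E) i)

lemma entryL_apply (i j : Fin 2) (A : Vec E) : entryL i j A = A i j := rfl

/-- The directional derivative of the determinant. -/
def detD (A v : Vec E) : E := A 0 0 * v 1 1 + A 1 1 * v 0 0 - (A 0 1 * v 1 0 + A 1 0 * v 0 1)

/-! ### Derivatives of `det` and of `ρ = |det|^{1/2}`. -/

lemma contDiff_detV : ContDiff ℝ ∞ (detV : Vec E → E) :=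
  ((entryL (E := E) 0 0).contDiff.mul (entryL 1 1).contDiff).sub
    ((entryL (E := E) 0 1).contDiff.mul (entryL 1 0).contDiff)

lemma fderiv_detV (A v : Vec E) : fderiv ℝ detV A v = detD A v := by
  have h := (((entryL (E := E) 0 0).hasFDerivAt (x := A)).mul (entryL 1 1).hasFDerivAt).sub
    (((entryL 0 1).hasFDerivAt (x := A)).mul (entryL 1 0).hasFDerivAt)
  have h2 : HasFDerivAt (detV : Vec E → E) _ A := h
  rw [h2.fderiv]
  simp [detD, entryL_apply]

/-- The fourth power is a real polynomial in the entries, whereas `ρ` and `ρ²` fail to be smooth at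
singular matrices. Smoothness and derivatives of `ρ` on `GL₂(E)` are read off from it. -/
lemma rho_pow_four (A : Vec E) : rho A ^ 4 = RCLike.reCLM (K := E) (detV A) ^ 2 +
    RCLike.imCLM (K := E) (detV A) ^ 2 := by
  rw [show 4 = 2 * 2 by norm_num, pow_mul, rho_sq, ← RCLike.normSq_eq_def', RCLike.normSq_apply]
  simp [pow_two]

lemma contDiff_rho_pow_four : ContDiff ℝ ∞ fun A : Vec E => rho A ^ 4 := by
  simp_rw [rho_pow_four]
  exact (((RCLike.reCLM (K := E)).contDiff.comp contDiff_detV).pow 2).add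
    (((RCLike.imCLM (K := E)).contDiff.comp contDiff_detV).pow 2)

lemma rho_pos_of_mem {A : Vec E} (hA : A ∈ unitSet E) : 0 < rho A :=
  Real.sqrt_pos.2 (norm_pos_iff.2 (detV_ne_zero.1 hA))

lemma contDiffAt_rho {A : Vec E} (hA : A ∈ unitSet E) : ContDiffAt ℝ ∞ rho A := by
  have h : (rho : Vec E → ℝ) = fun A => Real.sqrt (Real.sqrt (rho A ^ 4)) := by
    funext A
    have h0 : 0 ≤ rho A := Real.sqrt_nonneg _
    rw [show rho A ^ 4 = (rho A ^ 2) ^ 2 by ring, Real.sqrt_sq (by positivity), Real.sqrt_sq h0]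
  have h4 : 0 < rho A ^ 4 := pow_pos (rho_pos_of_mem hA) 4
  rw [h]
  exact (contDiff_rho_pow_four.contDiffAt.sqrt h4.ne').sqrt (Real.sqrt_pos.2 h4).ne'

/-- Differentiating `ρ⁴ = (Re det)² + (Im det)²` gives `4ρ³ρ' = 2 Re(τ) ρ⁴`; the imaginary part of
`τ` only rotates `det`. -/
lemma fderiv_rho {A v : Vec E} {τ : E} (hA : A ∈ unitSet E) (hv : detD A v = τ * detV A) :
    fderiv ℝ rho A v = RCLike.re τ / 2 * rho A := by
  have hd := ((contDiffAt_rho hA).differentiableAt (by simp)).hasFDerivAt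
  have h1 := hd.pow 4
  have hD : HasFDerivAt (detV : Vec E → E) (fderiv ℝ detV A) A :=
    (contDiff_detV.differentiable (by simp) A).hasFDerivAt
  have hre := ((RCLike.reCLM (K := E)).hasFDerivAt.comp A hD).pow 2
  have him := ((RCLike.imCLM (K := E)).hasFDerivAt.comp A hD).pow 2
  have h2 : HasFDerivAt (fun A : Vec E => rho A ^ 4) _ A :=
    (hre.add him).congr_of_eventuallyEq (Filter.Eventually.of_forall rho_pow_four)
  have h3 := congrArg (fun T : Vec E →L[ℝ] ℝ => T v) (h1.unique h2)
  have h4 := rho_pow_four A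
  simp [fderiv_detV, hv, RCLike.mul_re, RCLike.mul_im] at h3 h4
  have hr := rho_pos_of_mem hA
  have h5 : 0 < 4 * rho A ^ 3 := by positivity
  refine mul_left_cancel₀ h5.ne' ?_
  linear_combination h3 + (2 * RCLike.re τ) * (h4 : rho A ^ 4 = _) * (-1)

/-- The map `A ↦ (ρ(A) / r, (r / ρ(A)) A)` with `ρ(A) = |det A|^{1/2}`. -/
def polar (r : ℝ) (A : Vec E) : ℝ × Vec E := (r⁻¹ * rho A, (r * (rho A)⁻¹) • A)

lemma contDiffAt_polar (r : ℝ) {A : Vec E} (hA : A ∈ unitSet E) : ContDiffAt ℝ ∞ (polar r) A :=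
  (contDiffAt_const.mul (contDiffAt_rho hA)).prodMk
    ((contDiffAt_const.mul ((contDiffAt_rho hA).inv (rho_pos_of_mem hA).ne')).smul contDiffAt_id)

/-- The linear vector field on `ℝ × M₂(E)` corresponding to a linear vector field on `M₂(E)` that
scales `|det|^{1/2}` infinitesimally by `c`. -/
def polarField (v : Vec E →L[ℝ] Vec E) (c : ℝ) : ℝ × Vec E →L[ℝ] ℝ × Vec E :=
  (c • ContinuousLinearMap.fst ℝ ℝ (Vec E)).prod
    ((v - c • ContinuousLinearMap.id ℝ (Vec E)).comp (ContinuousLinearMap.snd ℝ ℝ (Vec E)))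

/-- The image field is linear and does not involve `r`. This is the source of the uniformity in `m`.
-/
lemma fderiv_polar (r : ℝ) {v : Vec E →L[ℝ] Vec E} {τ : E} {A : Vec E} (hA : A ∈ unitSet E)
    (hv : detD A (v A) = τ * detV A) :
    fderiv ℝ (polar r) A (v A) = polarField v (RCLike.re τ / 2) (polar r A) := by
  have hr := (rho_pos_of_mem hA).ne'
  have hd := ((contDiffAt_rho hA).differentiableAt (by simp)).hasFDerivAt
  have hi := (hasDerivAt_inv hr).comp_hasFDerivAt A hd
  have h : HasFDerivAt (polar r : Vec E → ℝ × Vec E) _ A :=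
    (hd.const_mul r⁻¹).prodMk ((hi.const_mul r).smul (hasFDerivAt_id A))
  rw [h.fderiv]
  simp only [polarField, polar, ContinuousLinearMap.prod_apply, _root_.smul_apply,
    _root_.add_apply, _root_.sub_apply, ContinuousLinearMap.comp_apply,
    ContinuousLinearMap.coe_fst', ContinuousLinearMap.coe_snd', ContinuousLinearMap.id_apply,
    ContinuousLinearMap.smulRight_apply, fderiv_rho hA hv, smul_eq_mul, map_smul,
    Function.comp_apply]
  refine Prod.ext ?_ ?_
  · simp only []; ring
  · simp only []
    rw [smul_sub, sub_eq_add_neg, smul_smul, ← neg_smul]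
    congr 2
    field_simp

/-- The function `g ↦ Θ(ρ(g) / r, (r / ρ(g)) g)`. -/
def pull (r : ℝ) (Θ : 𝓢(ℝ × Vec E, ℂ)) (g : GL (Fin 2) E) : ℂ := Θ (polar r (toVec g))

lemma ext_pull (r : ℝ) (Θ : 𝓢(ℝ × Vec E, ℂ)) {A : Vec E} (hA : A ∈ unitSet E) :
    ext (pull r Θ) A = Θ (polar r A) := by
  have h : IsUnit (Matrix.of A) := hA
  simp [ext, h, pull, toVec_unit]

lemma pull_mem (r : ℝ) (Θ : 𝓢(ℝ × Vec E, ℂ)) : pull r Θ ∈ Smooth E := by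
  change ContDiffOn ℝ ∞ (ext (pull r Θ)) (unitSet E)
  refine ContDiffOn.congr (f := fun A => Θ (polar r A)) (fun A hA => ?_) fun A hA => ext_pull r Θ hA
  exact ((Θ.contDiffAt ⊤).comp A (contDiffAt_polar r hA)).contDiffWithinAt

/-- `pull r Θ` as a smooth function. -/
def pullS (r : ℝ) (Θ : 𝓢(ℝ × Vec E, ℂ)) : Smooth E := ⟨pull r Θ, pull_mem r Θ⟩

lemma derivEnd_pullS (r : ℝ) (Θ : 𝓢(ℝ × Vec E, ℂ)) {v : Vec E →L[ℝ] Vec E} {τ : E}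
    (hv : ∀ A, detD A (v A) = τ * detV A) :
    derivEnd v (pullS r Θ) = pullS r (schwartzDeriv (polarField v (RCLike.re τ / 2)) Θ) := by
  apply Subtype.ext
  funext g
  have hg := toVec_mem g
  rw [derivEnd_apply]
  change fderiv ℝ (ext (pull r Θ)) (toVec g) (v (toVec g)) =
    schwartzDeriv (polarField v (RCLike.re τ / 2)) Θ (polar r (toVec g))
  have he : ext (pull r Θ) =ᶠ[nhds (toVec g)] Θ ∘ polar r := by
    filter_upwards [isOpen_unitSet.mem_nhds hg] with A hA using ext_pull r Θ hA
  rw [he.fderiv_eq, fderiv_comp _ Θ.differentiableAt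
    ((contDiffAt_polar r hg).differentiableAt (by simp)), ContinuousLinearMap.comp_apply,
    fderiv_polar r hg (hv _), schwartzDeriv_apply]

/-- Infinitesimal form of `det(exp(-sX) A) = exp(-s tr X) det A`. -/
lemma detD_leftField (X : Matrix (Fin 2) (Fin 2) E) (A : Vec E) :
    detD A (leftField X A) = -X.trace * detV A := by
  rw [leftField_apply]
  simp [detD, detV, Matrix.mul_apply, Matrix.trace, Fin.sum_univ_two]
  ring

lemma detD_rightField (X : Matrix (Fin 2) (Fin 2) E) (A : Vec E) :
    detD A (rightField X A) = -X.trace * detV A := by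
  rw [rightField_apply]
  simp [detD, detV, Matrix.mul_apply, Matrix.trace, Fin.sum_univ_two]
  ring

/-- The functions on `ℝ × M₂(E)` that vanish where the first coordinate has absolute value less
than `a`. -/
def VanishBelow (a : ℝ) (Θ : 𝓢(ℝ × Vec E, ℂ)) : Prop := ∀ p, |p.1| < a → Θ p = 0

/-- The strict inequality in `VanishBelow` makes the zero region open, so derivatives vanish there
too, with the same `a`. -/
lemma VanishBelow.schwartzDeriv {a : ℝ} {Θ : 𝓢(ℝ × Vec E, ℂ)} (h : VanishBelow a Θ)
    (w : ℝ × Vec E →L[ℝ] ℝ × Vec E) : VanishBelow a (schwartzDeriv w Θ) := by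
  intro p hp
  have ho : IsOpen {p : ℝ × Vec E | |p.1| < a} := isOpen_lt (by fun_prop) continuous_const
  have he : Θ =ᶠ[nhds p] fun _ => (0 : ℂ) := by
    filter_upwards [ho.mem_nhds hp] with q hq using h q hq
  rw [schwartzDeriv_apply, he.fderiv_eq]
  simp

/-- The operators on `C^∞(GL₂(E))` that lift to operators on Schwartz functions on
`ℝ × M₂(E)`. -/
def liftable (E : Type*) [RCLike E] : Subalgebra ℂ (Module.End ℂ (Smooth E)) where
  -- `Θ'` is chosen before `r`: one Schwartz function serves all `r` at once.
  carrier := {T | ∀ a Θ, VanishBelow a Θ → ∃ Θ', VanishBelow a Θ' ∧ ∀ r,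
    T (pullS r Θ) = pullS r Θ'}
  mul_mem' {S T} hS hT a Θ hΘ := by
    obtain ⟨Θ₁, h1, h1'⟩ := hT a Θ hΘ
    obtain ⟨Θ₂, h2, h2'⟩ := hS a Θ₁ h1
    exact ⟨Θ₂, h2, fun r => by rw [Module.End.mul_apply, h1', h2']⟩
  add_mem' {S T} hS hT a Θ hΘ := by
    obtain ⟨Θ₁, h1, h1'⟩ := hS a Θ hΘ
    obtain ⟨Θ₂, h2, h2'⟩ := hT a Θ hΘ
    refine ⟨Θ₁ + Θ₂, fun p hp => ?_, fun r => ?_⟩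
    · change Θ₁ p + Θ₂ p = 0
      rw [h1 p hp, h2 p hp, add_zero]
    · rw [LinearMap.add_apply, h1', h2']
      rfl
  algebraMap_mem' c a Θ hΘ := by
    refine ⟨c • Θ, fun p hp => ?_, fun r => ?_⟩
    · change c • Θ p = 0
      rw [hΘ p hp, smul_zero]
    · rw [Module.algebraMap_end_apply]
      rfl

lemma derivEnd_mem_liftable {v : Vec E →L[ℝ] Vec E} {τ : E}
    (hv : ∀ A, detD A (v A) = τ * detV A) : derivEnd v ∈ liftable E :=
  fun _ Θ hΘ => ⟨_, hΘ.schwartzDeriv _, fun r => derivEnd_pullS r Θ hv⟩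

/-- The enveloping algebra is a quotient of the tensor algebra, hence generated by the Lie algebra,
which is spanned by pure tensors. -/
lemma map_mem_of_map_ι_mem {A : Type*} [Semiring A] [Algebra ℂ A] (f : UEnv E →ₐ[ℂ] A)
    (S : Subalgebra ℂ A)
    (h : ∀ c : ℂ, ∀ X : Matrix (Fin 2) (Fin 2) E, f (UniversalEnvelopingAlgebra.ι ℂ (c ⊗ₜ[ℝ] X)) ∈ S)
    (X : UEnv E) : f X ∈ S := by
  have hι : ∀ x : LieC E, f (UniversalEnvelopingAlgebra.ι ℂ x) ∈ S := by
    intro x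
    induction x using TensorProduct.induction_on with
    | zero => rw [map_zero, map_zero]; exact S.zero_mem
    | add a b ha hb => rw [map_add, map_add]; exact S.add_mem ha hb
    | tmul c X => exact h c X
  have hs : Function.Surjective (UniversalEnvelopingAlgebra.mkAlgHom ℂ (LieC E)) :=
    Quotient.mk_surjective
  obtain ⟨t, rfl⟩ := hs X
  induction t using TensorAlgebra.induction with
  | algebraMap c => rw [AlgHom.commutes, AlgHom.commutes]; exact S.algebraMap_mem c
  | ι x => exact hι x
  | mul a b ha hb => rw [map_mul, map_mul]; exact S.mul_mem ha hb
  | add a b ha hb => rw [map_add, map_add]; exact S.add_mem ha hb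

lemma leftAct_mem_liftable (X : UEnv E) : leftAct X ∈ liftable E := by
  refine map_mem_of_map_ι_mem leftAct _ (fun c X => ?_) X
  rw [leftAct_ι]
  exact (liftable E).smul_mem (derivEnd_mem_liftable (detD_leftField X)) c

lemma rightAct_mem_liftable (X : UEnv E) : (rightAct X).unop ∈ liftable E := by
  refine map_mem_of_map_ι_mem rightAct (liftable E).op (fun c X => ?_) X
  change (rightAct (UniversalEnvelopingAlgebra.ι ℂ (c ⊗ₜ[ℝ] X))).unop ∈ liftable E
  rw [rightAct_ι]
  exact (liftable E).smul_mem (derivEnd_mem_liftable (detD_rightField X)) c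

lemma exists_biAct_pullS (X Y : UEnv E) {a : ℝ} {Θ : 𝓢(ℝ × Vec E, ℂ)} (hΘ : VanishBelow a Θ) :
    ∃ Θ', VanishBelow a Θ' ∧ ∀ r, biAct X Y (pullS r Θ) = pullS r Θ' := by
  obtain ⟨Θ₁, h1, h1'⟩ := rightAct_mem_liftable Y a Θ hΘ
  obtain ⟨Θ₂, h2, h2'⟩ := leftAct_mem_liftable X a Θ₁ h1
  exact ⟨Θ₂, h2, fun r => by rw [biAct, h1', h2']⟩

/-! ### The `L¹`-norm -/

lemma toVec_posUnit_mul (r : Set.Ioi (0 : ℝ)) (g : GL (Fin 2) E) :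
    toVec (GeneralLinearGroup.scalar (Fin 2) (posUnit r) * g) = (r : ℝ) • toVec g := by
  funext i j
  simp [toVec, GeneralLinearGroup.scalar, posUnit, RCLike.real_smul_eq_coe_mul]

lemma detV_smul (r : ℝ) (A : Vec E) : detV (r • A) = ((r ^ 2 : ℝ) : E) * detV A := by
  simp [detV, RCLike.real_smul_eq_coe_mul]
  ring

lemma rho_smul {r : ℝ} (hr : 0 ≤ r) (A : Vec E) : rho (r • A) = r * rho A := by
  rw [rho, detV_smul, norm_mul, RCLike.norm_ofReal, abs_of_nonneg (by positivity),
    Real.sqrt_mul (by positivity), Real.sqrt_sq hr, rho]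

lemma polar_smul {r : ℝ} (hr : 0 < r) (A : Vec E) :
    polar r (r • A) = (rho A, (r * (rho A)⁻¹) • A) := by
  rw [polar, rho_smul hr.le, smul_smul]
  refine Prod.ext ?_ ?_
  · field_simp
  · simp only []
    congr 1
    field_simp

/-- Translating by the scalar `r` moves the argument of `Θ` to `(ρ(g), (r/ρ(g)) g)`. The first
coordinate no longer involves `r`, so the support condition becomes `ρ(g) ≥ a`, and the power of `r`
comes from the decay in the second. -/
lemma lintegral_pull_le (μ : Measure (GL (Fin 2) E)) [μ.IsHaarMeasure] {a : ℝ} (ha : 0 < a)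
    {Θ : 𝓢(ℝ × Vec E, ℂ)} (hΘ : VanishBelow a Θ) (j : ℕ) :
    ∃ C : ℝ, 0 ≤ C ∧ ∀ r : ℝ, 0 < r → ∫⁻ g, ‖pull r Θ g‖ₑ ∂μ
      ≤ ENNReal.ofReal (C * (r ^ (2 * Module.finrank ℝ (Vec E) + 1 + j))⁻¹) := by
  set k := 2 * Module.finrank ℝ (Vec E) + 1 + j with hk
  have hI := lintegral_inv_norm_pow_lt_top μ j ha
  rw [← hk] at hI
  set I := ∫⁻ g in {g : GL (Fin 2) E | a ≤ rho (toVec g)}, ENNReal.ofReal ((‖toVec g‖ ^ k)⁻¹) ∂μ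
  -- Order `2k` is needed because the norms of the two coordinates multiply to `r‖g‖`, whence only
  -- `‖p‖² ≥ r‖g‖`.
  obtain ⟨C, hC0, hC⟩ := Θ.decay (k + k) 0
  have hms : MeasurableSet {g : GL (Fin 2) E | a ≤ rho (toVec g)} :=
    (isClosed_le continuous_const (continuous_rho.comp continuous_toVec)).measurableSet
  refine ⟨C * I.toReal, by positivity, fun r hr => ?_⟩
  set s : GL (Fin 2) E := GeneralLinearGroup.scalar (Fin 2) (posUnit ⟨r, hr⟩) with hs
  rw [← lintegral_mul_left_eq_self _ s]
  have hpt : ∀ g : GL (Fin 2) E, ‖pull r Θ (s * g)‖ₑ ≤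
      {g : GL (Fin 2) E | a ≤ rho (toVec g)}.indicator (fun g =>
        ENNReal.ofReal (C * (r ^ k)⁻¹) * ENNReal.ofReal ((‖toVec g‖ ^ k)⁻¹)) g := by
    intro g
    have e : pull r Θ (s * g) = Θ (rho (toVec g), (r * (rho (toVec g))⁻¹) • toVec g) := by
      rw [pull, hs, toVec_posUnit_mul]
      exact congrArg Θ (polar_smul hr _)
    have hρ := rho_pos g
    rw [e]
    by_cases hg : a ≤ rho (toVec g)
    · rw [Set.indicator_of_mem (by exact hg), ← ENNReal.ofReal_mul (by positivity),
        ← ofReal_norm]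
      apply ENNReal.ofReal_le_ofReal
      have h1 := hC (rho (toVec g), (r * (rho (toVec g))⁻¹) • toVec g)
      rw [norm_iteratedFDeriv_zero] at h1
      set p : ℝ × Vec E := (rho (toVec g), (r * (rho (toVec g))⁻¹) • toVec g) with hp
      have hp1 : rho (toVec g) ≤ ‖p‖ := by
        refine le_trans ?_ (norm_fst_le p)
        rw [Real.norm_of_nonneg hρ.le]
      have hp2 : r * (rho (toVec g))⁻¹ * ‖toVec g‖ ≤ ‖p‖ := by
        refine le_trans ?_ (norm_snd_le p)
        rw [norm_smul, Real.norm_of_nonneg (by positivity)]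
      have hpos : 0 < ‖toVec g‖ := by linarith [rho_le (toVec g)]
      have h2 : r ^ k * ‖toVec g‖ ^ k ≤ ‖p‖ ^ (k + k) := by
        calc r ^ k * ‖toVec g‖ ^ k
            = rho (toVec g) ^ k * (r * (rho (toVec g))⁻¹ * ‖toVec g‖) ^ k := by
              rw [← mul_pow, ← mul_pow]; congr 1; field_simp
          _ ≤ ‖p‖ ^ k * ‖p‖ ^ k := by gcongr
          _ = ‖p‖ ^ (k + k) := (pow_add _ _ _).symm
      rw [mul_assoc, ← mul_inv, ← div_eq_mul_inv, le_div_iff₀ (by positivity), mul_comm]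
      exact (mul_le_mul_of_nonneg_right h2 (norm_nonneg _)).trans h1
    · rw [hΘ _ (by simpa [abs_of_pos hρ] using hg)]
      simp
  calc ∫⁻ g, ‖pull r Θ (s * g)‖ₑ ∂μ
      ≤ ∫⁻ g in {g : GL (Fin 2) E | a ≤ rho (toVec g)},
        ENNReal.ofReal (C * (r ^ k)⁻¹) * ENNReal.ofReal ((‖toVec g‖ ^ k)⁻¹) ∂μ := by
        rw [← lintegral_indicator hms]
        exact lintegral_mono hpt
    _ = ENNReal.ofReal (C * (r ^ k)⁻¹) * I := lintegral_const_mul' _ _ ENNReal.ofReal_ne_top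
    _ = ENNReal.ofReal (C * I.toReal * (r ^ k)⁻¹) := by
        nth_rewrite 1 [← ENNReal.ofReal_toReal hI.ne]
        rw [← ENNReal.ofReal_mul (by positivity)]
        congr 1
        ring

end Pull

/-! ### The convolutions `Ψ * 𝕎_h` -/

section Conv

open scoped SchwartzMap

/-! ### Test functions extended by zero to `M₂(E)`, and the Gaussian. -/

lemma hasCompactSupport_ext {Ψ : GL (Fin 2) E → ℂ} (hΨ : HasCompactSupport Ψ) :
    HasCompactSupport (ext Ψ) := by
  refine HasCompactSupport.intro (hΨ.image continuous_toVec) fun A hA => ?_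
  by_cases h : IsUnit (Matrix.of A)
  · rw [ext, dif_pos h]
    exact image_eq_zero_of_notMem_tsupport fun h2 => hA ⟨_, h2, toVec_unit h⟩
  · rw [ext, dif_neg h]

/-- The support is compact, hence closed in `M₂(E)`, so the extension vanishes near every singular
matrix. -/
lemma contDiff_ext {Ψ : GL (Fin 2) E → ℂ} (hΨ : Ψ ∈ TestFun E) : ContDiff ℝ ∞ (ext Ψ) := by
  rw [contDiff_iff_contDiffAt]
  intro A
  by_cases hA : A ∈ unitSet E
  · exact contDiffAt_ext ⟨Ψ, hΨ.1⟩ hA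
  · have hc : IsClosed (toVec '' tsupport Ψ) := (hΨ.2.image continuous_toVec).isClosed
    have hn : A ∉ toVec '' tsupport Ψ := by
      rintro ⟨g, -, rfl⟩
      exact hA (toVec_mem g)
    have he : ext Ψ =ᶠ[nhds A] fun _ => 0 := by
      filter_upwards [hc.isOpen_compl.mem_nhds hn] with B hB
      by_cases h : IsUnit (Matrix.of B)
      · rw [ext, dif_pos h]
        exact image_eq_zero_of_notMem_tsupport fun h2 => hB ⟨_, h2, toVec_unit h⟩
      · rw [ext, dif_neg h]
    exact contDiffAt_const.congr_of_eventuallyEq he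

lemma exists_of_ext_ne_zero {Ψ : GL (Fin 2) E → ℂ} {A : Vec E} (h : ext Ψ A ≠ 0) :
    ∃ y ∈ tsupport Ψ, toVec y = A := by
  by_cases hA : IsUnit (Matrix.of A)
  · rw [ext, dif_pos hA] at h
    exact ⟨_, subset_tsupport _ h, toVec_unit hA⟩
  · exact absurd (by rw [ext, dif_neg hA]) h

/-- The bilinear form `d · Re tr(A^* B)`. -/
def traceForm (E : Type*) [RCLike E] : Vec E →L[ℝ] Vec E →L[ℝ] ℝ :=
  LinearMap.toContinuousBilinearMap (𝕜 := ℝ) (LinearMap.mk₂ ℝ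
    (fun A B : Vec E => (Module.finrank ℝ E : ℝ) *
      RCLike.re (((Matrix.of A)ᴴ * Matrix.of B).trace))
    (fun A B C => by
      rw [show Matrix.of (A + B) = Matrix.of A + Matrix.of B from rfl, Matrix.conjTranspose_add,
        add_mul, Matrix.trace_add, map_add, mul_add])
    (fun c A B => by
      rw [show Matrix.of (c • A) = c • Matrix.of A from rfl, Matrix.conjTranspose_smul,
        smul_mul_assoc, Matrix.trace_smul, star_trivial, RCLike.smul_re, smul_eq_mul]
      ring)
    (fun A B C => by
      rw [show Matrix.of (B + C) = Matrix.of B + Matrix.of C from rfl,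
        mul_add, Matrix.trace_add, map_add, mul_add])
    (fun c A B => by
      rw [show Matrix.of (c • B) = c • Matrix.of B from rfl,
        mul_smul_comm, Matrix.trace_smul, RCLike.smul_re, smul_eq_mul]
      ring))

lemma traceForm_apply (A B : Vec E) : traceForm E A B = (Module.finrank ℝ E : ℝ) *
    RCLike.re (((Matrix.of A)ᴴ * Matrix.of B).trace) := rfl

/-- The Frobenius norm dominates the sup norm, and `d ≥ 1`. The factor 1 is the constant `c` of
`exists_schwartz_gaussian`. -/
lemma norm_sq_le_traceForm (A : Vec E) : 1 * ‖A‖ ^ 2 ≤ traceForm E A A := by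
  have h1 : (1 : ℝ) ≤ Module.finrank ℝ E := by exact_mod_cast Module.finrank_pos (R := ℝ) (M := E)
  have h2 : RCLike.re (((Matrix.of A)ᴴ * Matrix.of A).trace) =
      ‖A 0 0‖ ^ 2 + ‖A 1 0‖ ^ 2 + (‖A 0 1‖ ^ 2 + ‖A 1 1‖ ^ 2) := by
    simp only [Matrix.trace, Fin.sum_univ_two, Matrix.diag_apply, Matrix.mul_apply,
      Matrix.conjTranspose_apply, Matrix.of_apply, ← starRingEnd_apply, RCLike.conj_mul, map_add]
    norm_cast
  have h3 : ‖A‖ ≤ Real.sqrt (‖A 0 0‖ ^ 2 + ‖A 1 0‖ ^ 2 + (‖A 0 1‖ ^ 2 + ‖A 1 1‖ ^ 2)) := by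
    rw [pi_norm_le_iff_of_nonneg (Real.sqrt_nonneg _)]
    intro i
    rw [pi_norm_le_iff_of_nonneg (Real.sqrt_nonneg _)]
    intro j
    apply Real.le_sqrt_of_sq_le
    fin_cases i <;> fin_cases j <;> simp <;> nlinarith [sq_nonneg ‖A 0 0‖, sq_nonneg ‖A 0 1‖,
      sq_nonneg ‖A 1 0‖, sq_nonneg ‖A 1 1‖]
  have h4 := pow_le_pow_left₀ (norm_nonneg A) h3 2
  rw [Real.sq_sqrt (by positivity)] at h4
  rw [traceForm_apply, h2]
  gcongr

lemma F1_eq (g : GL (Fin 2) E) : F1 g =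
    ((Real.exp (-(traceForm E (toVec g) (toVec g))) *
      absN (detV (toVec g)) ^ (1 / 2 : ℝ) : ℝ) : ℂ) := by
  rw [F1, traceForm_apply, detV_toVec, neg_mul]
  rfl

/-! ### `GL₂(E)¹` inside `M₂(E)`. -/

lemma norm_detV_GL1 (g : GL1 E) : ‖detV (toVec (g : GL (Fin 2) E))‖ = 1 := by
  rw [detV_toVec]
  exact mem_GL1.1 g.2

lemma rho_GL1 (g : GL1 E) : rho (toVec (g : GL (Fin 2) E)) = 1 := by
  rw [rho, norm_detV_GL1, Real.sqrt_one]

/-- Unlike `GL₂(E)`, the set `‖det‖ = 1` is closed in `M₂(E)`, so closed bounded subsets of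
`GL₂(E)¹` are compact. -/
lemma isClosedEmbedding_toVec_GL1 :
    Topology.IsClosedEmbedding fun g : GL1 E => toVec (g : GL (Fin 2) E) := by
  refine ⟨isOpenEmbedding_toVec.isEmbedding.comp Topology.IsEmbedding.subtypeVal, ?_⟩
  have h : Set.range (fun g : GL1 E => toVec (g : GL (Fin 2) E)) = {A | ‖detV A‖ = 1} := by
    ext A
    constructor
    · rintro ⟨g, rfl⟩
      exact norm_detV_GL1 g
    · intro (hA : ‖detV A‖ = 1)
      have hu : A ∈ unitSet E := detV_ne_zero.2 fun h0 => by simp [h0] at hA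
      rw [← range_toVec] at hu
      obtain ⟨g, rfl⟩ := hu
      exact ⟨⟨g, mem_GL1.2 (by rwa [← detV_toVec])⟩, rfl⟩
  rw [h]
  exact isClosed_eq contDiff_detV.continuous.norm continuous_const

lemma isCompact_inv_norm_le (M : ℝ) :
    IsCompact {g : GL1 E | ‖toVec ((g⁻¹ : GL1 E) : GL (Fin 2) E)‖ ≤ M} := by
  have h := isClosedEmbedding_toVec_GL1.isCompact_preimage (isCompact_closedBall (0 : Vec E) M)
  have h2 := h.inv
  convert h2 using 1
  ext g
  simp

/-- The linear map `(σ, B) ↦ (g B, σ g⁻¹)`. -/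
def pairL (g : GL1 E) : ℝ × Vec E →L[ℝ] Vec E × Vec E :=
  (ContinuousLinearMap.inl ℝ (Vec E) (Vec E)).comp
    ((mulL (toVec (g : GL (Fin 2) E))).comp (ContinuousLinearMap.snd ℝ ℝ (Vec E))) +
  (ContinuousLinearMap.inr ℝ (Vec E) (Vec E)).comp
    ((ContinuousLinearMap.fst ℝ ℝ (Vec E)).smulRight (toVec ((g⁻¹ : GL1 E) : GL (Fin 2) E)))

lemma pairL_apply (g : GL1 E) (p : ℝ × Vec E) : pairL g p =
    (mulL (toVec (g : GL (Fin 2) E)) p.2, p.1 • toVec ((g⁻¹ : GL1 E) : GL (Fin 2) E)) := by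
  simp [pairL]

lemma continuous_mulL_GL1 : Continuous fun g : GL1 E => mulL (toVec (g : GL (Fin 2) E)) :=
  (mulB E).continuous.comp (continuous_toVec.comp continuous_subtype_val)

lemma continuous_pairL : Continuous (pairL : GL1 E → _) := by
  refine Continuous.add ?_ ?_
  · exact continuous_const.clm_comp (continuous_mulL_GL1.clm_comp continuous_const)
  · refine continuous_const.clm_comp ?_
    exact (ContinuousLinearMap.smulRightL ℝ (ℝ × Vec E) (Vec E)
      (ContinuousLinearMap.fst ℝ ℝ (Vec E))).continuous.comp
      (continuous_toVec.comp (continuous_subtype_val.comp continuous_inv))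

/-- `B` is recovered as `g⁻¹(gB)`, and `σ` from `σ g⁻¹` because `ρ(g⁻¹) = 1` forces `‖g⁻¹‖ ≥ 1/2`.
The constant is bounded on compact sets of `g`. -/
lemma norm_le_pairL (g : GL1 E) (p : ℝ × Vec E) :
    ‖p‖ ≤ (2 + ‖mulL (toVec ((g⁻¹ : GL1 E) : GL (Fin 2) E))‖) * ‖pairL g p‖ := by
  rw [pairL_apply]
  set q : Vec E × Vec E := (mulL (toVec (g : GL (Fin 2) E)) p.2,
    p.1 • toVec ((g⁻¹ : GL1 E) : GL (Fin 2) E)) with hq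
  have h1 : ‖p.1‖ ≤ 2 * ‖q‖ := by
    have := norm_snd_le q
    rw [hq, norm_smul, ← hq] at this
    have h2 := rho_le (toVec ((g⁻¹ : GL1 E) : GL (Fin 2) E))
    rw [rho_GL1] at h2
    nlinarith [norm_nonneg p.1]
  have h2 : ‖p.2‖ ≤ ‖mulL (toVec ((g⁻¹ : GL1 E) : GL (Fin 2) E))‖ * ‖q‖ := by
    have e : mulL (toVec ((g⁻¹ : GL1 E) : GL (Fin 2) E)) q.1 = p.2 := by
      rw [hq, ← ContinuousLinearMap.comp_apply, ← mulL_toVec_mul, ← Subgroup.coe_mul,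
        inv_mul_cancel, Subgroup.coe_one, mulL_toVec_one]
      rfl
    calc ‖p.2‖ = ‖mulL (toVec ((g⁻¹ : GL1 E) : GL (Fin 2) E)) q.1‖ := by rw [e]
      _ ≤ ‖mulL (toVec ((g⁻¹ : GL1 E) : GL (Fin 2) E))‖ * ‖q.1‖ :=
        ContinuousLinearMap.le_opNorm _ _
      _ ≤ _ := by gcongr; exact norm_fst_le q
  have h3 : 0 ≤ ‖mulL (toVec ((g⁻¹ : GL1 E) : GL (Fin 2) E))‖ := norm_nonneg _
  rw [Prod.norm_def, max_le_iff]
  constructor <;> nlinarith [norm_nonneg q]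

lemma rho_smul' (c : E) (A : Vec E) : rho (c • A) = ‖c‖ * rho A := by
  have h : detV (c • A) = c ^ 2 * detV A := by simp [detV]; ring
  rw [rho, h, norm_mul, norm_pow, Real.sqrt_mul (by positivity), Real.sqrt_sq (norm_nonneg _), rho]

/-- The Schwartz function from which the convolutions `Ψ * 𝕎_h` are obtained. -/
lemma exists_kernel (ν : Measure (GL1 E)) [ν.IsHaarMeasure] {Ψ : GL (Fin 2) E → ℂ}
    (hΨ : Ψ ∈ TestFun E) (z : Eˣ) :
    ∃ a > 0, ∃ Θ : 𝓢(ℝ × Vec E, ℂ), VanishBelow a Θ ∧ ∀ p, Θ p = ∫ g : GL1 E,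
      Real.exp (-(traceForm E (mulL (toVec (g : GL (Fin 2) E)) p.2)
        (mulL (toVec (g : GL (Fin 2) E)) p.2))) •
      ext Ψ (((z⁻¹ : Eˣ) : E) • p.1 • toVec ((g⁻¹ : GL1 E) : GL (Fin 2) E)) ∂ν := by
  obtain ⟨S₁, hS₁⟩ := exists_schwartz_gaussian (traceForm E) one_pos norm_sq_le_traceForm
  have hz : ((z⁻¹ : Eˣ) : E) ≠ 0 := (z⁻¹).ne_zero
  have hcs : HasCompactSupport fun A : Vec E => ext Ψ (((z⁻¹ : Eˣ) : E) • A) :=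
    (hasCompactSupport_ext hΨ.2).comp_homeomorph (Homeomorph.smulOfNeZero _ hz)
  have hcd : ContDiff ℝ ∞ fun A : Vec E => ext Ψ (((z⁻¹ : Eˣ) : E) • A) :=
    (contDiff_ext hΨ).comp (contDiff_const_smul _)
  obtain ⟨S, hS⟩ := exists_schwartz_prod S₁ (hcs.toSchwartzMap hcd)
  have hS' : ∀ (g : GL1 E) (p : ℝ × Vec E), S (pairL g p) =
      Real.exp (-(traceForm E (mulL (toVec (g : GL (Fin 2) E)) p.2)
        (mulL (toVec (g : GL (Fin 2) E)) p.2))) •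
      ext Ψ (((z⁻¹ : Eˣ) : E) • p.1 • toVec ((g⁻¹ : GL1 E) : GL (Fin 2) E)) := by
    intro g p
    rw [hS, hS₁, pairL_apply]
    rfl
  have hρc : Continuous fun y : GL (Fin 2) E => (rho (toVec y))⁻¹ :=
    (continuous_rho.comp continuous_toVec).inv₀ fun y => (rho_pos y).ne'
  obtain ⟨M, hM⟩ := hΨ.2.isCompact.exists_bound_of_continuousOn
    (f := fun y : GL (Fin 2) E => (rho (toVec y))⁻¹ • toVec y)
    (hρc.smul continuous_toVec).continuousOn
  obtain ⟨C, hC⟩ := hΨ.2.isCompact.exists_bound_of_continuousOn hρc.continuousOn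
  -- If `y = z⁻¹ σ g⁻¹` lies in the support, then `ρ(y) = |σ|/‖z‖`. So `y/ρ(y)` is `g⁻¹` up to a
  -- scalar of norm 1, which gives the bound `M`, and `ρ(y)⁻¹ ≤ C` bounds `|σ|` below. `|C| + 1` is
  -- used to have a positive denominator.
  have hsupp : ∀ (g : GL1 E) (σ : ℝ),
      ext Ψ (((z⁻¹ : Eˣ) : E) • σ • toVec ((g⁻¹ : GL1 E) : GL (Fin 2) E)) ≠ 0 →
      ‖toVec ((g⁻¹ : GL1 E) : GL (Fin 2) E)‖ ≤ M ∧ ‖(z : E)‖ / (|C| + 1) ≤ |σ| := by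
    intro g σ h
    obtain ⟨y, hy, hyA⟩ := exists_of_ext_ne_zero h
    have h1 : rho (toVec y) = ‖(z : E)‖⁻¹ * |σ| := by
      rw [hyA, rho_smul', RCLike.real_smul_eq_coe_smul (K := E), rho_smul', rho_GL1]
      simp
    have hzn : 0 < ‖(z : E)‖ := norm_pos_iff.2 z.ne_zero
    have h0 := rho_pos y
    constructor
    · refine le_trans (le_of_eq ?_) (hM y hy)
      rw [norm_smul, norm_inv, Real.norm_of_nonneg h0.le]
      nth_rewrite 2 [hyA]
      rw [norm_smul, norm_smul, ← mul_assoc]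
      have h2 : ‖((z⁻¹ : Eˣ) : E)‖ * ‖σ‖ = rho (toVec y) := by
        rw [h1]; simp
      rw [← mul_assoc, mul_assoc (rho (toVec y))⁻¹, h2, inv_mul_cancel₀ h0.ne', one_mul]
    · have h2 := (hC y hy).trans (le_abs_self C)
      rw [norm_inv, Real.norm_of_nonneg h0.le] at h2
      have h3 : (rho (toVec y))⁻¹ ≤ |C| + 1 := by linarith
      rw [inv_le_iff_one_le_mul₀ h0, h1] at h3
      rw [div_le_iff₀ (by positivity)]
      have h4 := mul_le_mul_of_nonneg_left h3 hzn.le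
      calc ‖(z : E)‖ = ‖(z : E)‖ * 1 := (mul_one _).symm
        _ ≤ _ := h4
        _ = |σ| * (|C| + 1) := by field_simp
  set K : Set (GL1 E) := {g | ‖toVec ((g⁻¹ : GL1 E) : GL (Fin 2) E)‖ ≤ M} with hK
  have hKc : IsCompact K := isCompact_inv_norm_le M
  obtain ⟨M₁, hM₁⟩ := hKc.exists_bound_of_continuousOn (continuous_pairL (E := E)).continuousOn
  obtain ⟨M₂, hM₂⟩ := hKc.exists_bound_of_continuousOn
    (continuous_mulL_GL1.comp (continuous_inv (G := GL1 E))).continuousOn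
  have : IsFiniteMeasure (ν.restrict K) := ⟨by
    rw [Measure.restrict_apply_univ]; exact hKc.measure_lt_top⟩
  obtain ⟨Θ, hΘ⟩ := exists_schwartz_integral (ν.restrict K) S pairL continuous_pairL
    (M := |M₁| + (2 + |M₂|)) (by positivity)
    (ae_restrict_of_forall_mem hKc.measurableSet fun g hg =>
      (hM₁ g hg).trans ((le_abs_self _).trans (le_add_of_nonneg_right (by positivity))))
    (ae_restrict_of_forall_mem hKc.measurableSet fun g hg p => by
      refine (norm_le_pairL g p).trans ?_
      have h1 : ‖mulL (toVec ((g⁻¹ : GL1 E) : GL (Fin 2) E))‖ ≤ |M₂| :=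
        (hM₂ g hg).trans (le_abs_self _)
      exact mul_le_mul_of_nonneg_right (by linarith [abs_nonneg M₁]) (norm_nonneg _))
  -- The integrand vanishes off `K` for every `p`, so restricting to the finite measure on `K` loses
  -- nothing.
  have hΘ' : ∀ p, Θ p = ∫ g : GL1 E, S (pairL g p) ∂ν := by
    intro p
    rw [hΘ p]
    refine setIntegral_eq_integral_of_forall_compl_eq_zero fun g hg => ?_
    by_contra h
    rw [hS'] at h
    exact hg (hsupp g p.1 (right_ne_zero_of_smul h)).1
  refine ⟨‖(z : E)‖ / (|C| + 1), ?_, Θ, fun p hp => ?_, fun p => ?_⟩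
  · have : 0 < ‖(z : E)‖ := norm_pos_iff.2 z.ne_zero
    positivity
  · rw [hΘ' p]
    refine integral_eq_zero_of_ae (Filter.Eventually.of_forall fun g => ?_)
    by_contra h
    change S (pairL g p) ≠ 0 at h
    rw [hS'] at h
    exact hp.not_ge (hsupp g p.1 (right_ne_zero_of_smul h)).2
  · rw [hΘ' p]
    exact integral_congr_ae (Filter.Eventually.of_forall fun g => hS' g p)

/-! ### The convolution formula and the resulting estimate. -/

lemma coe_scalar_mul (u : Eˣ) (g : GL (Fin 2) E) :
    ((GeneralLinearGroup.scalar (Fin 2) u * g : GL (Fin 2) E) : Matrix (Fin 2) (Fin 2) E)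
      = (u : E) • (g : Matrix (Fin 2) (Fin 2) E) := by
  ext i j
  simp [GeneralLinearGroup.scalar]

lemma toVec_scalar_mul (u : Eˣ) (g : GL (Fin 2) E) :
    toVec (GeneralLinearGroup.scalar (Fin 2) u * g) = (u : E) • toVec g :=
  congrArg Matrix.of.symm (coe_scalar_mul u g)

/-- The element `g / ρ(g)` of `GL₂(E)¹`. -/
def normalize (g : GL (Fin 2) E) : GL1 E :=
  ⟨GeneralLinearGroup.scalar (Fin 2) (posUnit ⟨(rho (toVec g))⁻¹, inv_pos.2 (rho_pos g)⟩) * g, by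
    rw [mem_GL1, ← detV_toVec, ← rho_sq, toVec_posUnit_mul, rho_smul (inv_nonneg.2 (rho_pos g).le)]
    change ((rho (toVec g))⁻¹ * rho (toVec g)) ^ 2 = 1
    rw [inv_mul_cancel₀ (rho_pos g).ne', one_pow]⟩

lemma coe_normalize (g : GL (Fin 2) E) : (normalize g : GL (Fin 2) E) =
    GeneralLinearGroup.scalar (Fin 2) (posUnit ⟨(rho (toVec g))⁻¹, inv_pos.2 (rho_pos g)⟩) * g := rfl

lemma rootAbs_pow (m : Eˣ) (n : ℕ) :
    (rootAbs m : ℝ) ^ n = absN (m : E) ^ ((n : ℝ) / (2 * Module.finrank ℝ E)) := by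
  rw [← Real.rpow_natCast, rootAbs, ← Real.rpow_mul (absN_pos m).le]
  congr 1
  ring

lemma rootAbs_pow_finrank (m : Eˣ) :
    (rootAbs m : ℝ) ^ Module.finrank ℝ E = absN (m : E) ^ (1 / 2 : ℝ) := by
  rw [rootAbs_pow]
  congr 1
  have : (Module.finrank ℝ E : ℝ) ≠ 0 := by exact_mod_cast Module.finrank_pos.ne'
  field_simp

lemma F1_GL1 (r : Set.Ioi (0 : ℝ)) (g : GL1 E) :
    F1 (GeneralLinearGroup.scalar (Fin 2) (posUnit r) * (g : GL (Fin 2) E)) =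
      ((Real.exp (-(traceForm E ((r : ℝ) • toVec (g : GL (Fin 2) E))
        ((r : ℝ) • toVec (g : GL (Fin 2) E)))) * (r : ℝ) ^ Module.finrank ℝ E : ℝ) : ℂ) := by
  have hr : (0 : ℝ) < r := r.2
  rw [F1_eq, toVec_posUnit_mul]
  congr 2
  rw [absN, detV_smul, norm_mul, norm_detV_GL1, mul_one, RCLike.norm_ofReal,
    abs_of_nonneg (by positivity), ← Real.rpow_natCast, ← Real.rpow_natCast, ← Real.rpow_mul hr.le,
    ← Real.rpow_natCast, ← Real.rpow_mul hr.le]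
  congr 1
  push_cast
  ring

/-- The substitution `g ↦ g · normalize x` turns `r g` into `g B` and the argument of `Ψ` into `z⁻¹
σ g⁻¹`. On `r · GL₂(E)¹` the factor `|det|^{1/2}` of `F1` is `r^d = |m|^{1/2}`; with the prefactor
`|m|^{1/2}/2` it makes `|m|/2`. -/
lemma conv_WCoord (ν : Measure (GL1 E)) [ν.IsHaarMeasure] {Ψ : GL (Fin 2) E → ℂ}
    (t : E) (z m : Eˣ) {Θ : 𝓢(ℝ × Vec E, ℂ)}
    (hΘ : ∀ p, Θ p = ∫ g : GL1 E,
      Real.exp (-(traceForm E (mulL (toVec (g : GL (Fin 2) E)) p.2)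
        (mulL (toVec (g : GL (Fin 2) E)) p.2))) •
      ext Ψ (((z⁻¹ : Eˣ) : E) • p.1 • toVec ((g⁻¹ : GL1 E) : GL (Fin 2) E)) ∂ν) :
    conv Ψ (WCoord ν t z m) =
      (psi t / 2 * (absN (m : E) : ℝ)) • pull (rootAbs m) Θ := by
  have := isMulRightInvariant_of_haar ν
  funext x
  set r := rootAbs m with hr
  have hr0 : (0 : ℝ) < r := r.2
  have hρ := rho_pos x
  change (psi t * (absN (m : E) ^ (1 / 2 : ℝ) : ℝ) / 2) *
    ∫ g : GL1 E, F1 (GeneralLinearGroup.scalar (Fin 2) (posUnit r) * (g : GL (Fin 2) E)) *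
      Ψ (x * (GeneralLinearGroup.scalar (Fin 2) z *
        (GeneralLinearGroup.scalar (Fin 2) (posUnit r) * (g : GL (Fin 2) E)))⁻¹) ∂ν = _
  rw [← integral_mul_right_eq_self _ (normalize x)]
  have hpt : ∀ g : GL1 E,
      F1 (GeneralLinearGroup.scalar (Fin 2) (posUnit r) *
        ((g * normalize x : GL1 E) : GL (Fin 2) E)) *
      Ψ (x * (GeneralLinearGroup.scalar (Fin 2) z *
        (GeneralLinearGroup.scalar (Fin 2) (posUnit r) *
          ((g * normalize x : GL1 E) : GL (Fin 2) E)))⁻¹) =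
      ((absN (m : E) ^ (1 / 2 : ℝ) : ℝ) : ℂ) *
        (Real.exp (-(traceForm E (mulL (toVec (g : GL (Fin 2) E)) (polar r (toVec x)).2)
          (mulL (toVec (g : GL (Fin 2) E)) (polar r (toVec x)).2))) •
        ext Ψ (((z⁻¹ : Eˣ) : E) • (polar r (toVec x)).1 •
          toVec ((g⁻¹ : GL1 E) : GL (Fin 2) E))) := by
    intro g
    have hB : (r : ℝ) • toVec ((g * normalize x : GL1 E) : GL (Fin 2) E) =
        mulL (toVec (g : GL (Fin 2) E)) (polar r (toVec x)).2 := by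
      rw [Subgroup.coe_mul, ← mulL_toVec, coe_normalize, toVec_posUnit_mul, ← map_smul, smul_smul]
      rfl
    have hA : x * (GeneralLinearGroup.scalar (Fin 2) z *
        (GeneralLinearGroup.scalar (Fin 2) (posUnit r) *
          ((g * normalize x : GL1 E) : GL (Fin 2) E)))⁻¹ =
        GeneralLinearGroup.scalar (Fin 2) z⁻¹ * (GeneralLinearGroup.scalar (Fin 2)
          (posUnit ⟨(r : ℝ)⁻¹ * rho (toVec x), mul_pos (inv_pos.2 hr0) hρ⟩) *
            ((g⁻¹ : GL1 E) : GL (Fin 2) E)) := by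
      rw [mul_inv_eq_iff_eq_mul]
      apply Units.ext
      rw [Units.val_mul, coe_scalar_mul, coe_scalar_mul, coe_scalar_mul, coe_scalar_mul,
        Subgroup.coe_mul, Units.val_mul, coe_normalize, coe_scalar_mul]
      simp only [smul_mul_assoc, mul_smul_comm, smul_smul, Subgroup.coe_inv]
      rw [← Matrix.mul_assoc, Units.inv_mul, Matrix.one_mul]
      have hone : ∀ c : E, c = 1 → (x : Matrix (Fin 2) (Fin 2) E) =
          c • (x : Matrix (Fin 2) (Fin 2) E) := fun c hc => by rw [hc, one_smul]
      apply hone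
      have h1 : ((r : ℝ) : E) ≠ 0 := by exact_mod_cast hr0.ne'
      have h2 : ((rho (toVec x) : ℝ) : E) ≠ 0 := by exact_mod_cast hρ.ne'
      simp only [posUnit, Units.val_mk0]
      push_cast
      have h3 := z.ne_zero
      field_simp
    rw [F1_GL1, hB, hA, ← ext_toVec Ψ, toVec_scalar_mul, toVec_posUnit_mul, ← rootAbs_pow_finrank,
      ← hr, Complex.real_smul]
    push_cast
    simp only [polar]
    ring
  simp_rw [hpt]
  rw [integral_const_mul]
  change _ = (psi t / 2 * (absN (m : E) : ℝ)) * Θ (polar r (toVec x))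
  rw [hΘ, ← mul_assoc]
  congr 1
  have h2 : absN (m : E) = absN (m : E) ^ (1 / 2 : ℝ) * absN (m : E) ^ (1 / 2 : ℝ) := by
    rw [← Real.rpow_add (absN_pos m)]; norm_num
  nth_rewrite 3 [h2]
  push_cast
  ring

/-- In the exponent, 1 is the factor `|m|` of `conv_WCoord`, and the rest is `r^{-k}` with `r =
|m|^{1/(2d)}`. The constant does not depend on `t` or `m`, and `j` is free. -/
theorem conv_WCoord_bound (μ : Measure (GL (Fin 2) E)) [μ.IsHaarMeasure] (ν : Measure (GL1 E))
    [ν.IsHaarMeasure] {Ψ : GL (Fin 2) E → ℂ} (hΨ : Ψ ∈ TestFun E) (z : Eˣ) :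
    (∀ t m, conv Ψ (WCoord ν t z m) ∈ Smooth E) ∧
    ∀ (X Y : UEnv E) (j : ℕ), ∃ C : ℝ, 0 ≤ C ∧ ∀ t m, l1Norm μ X Y (conv Ψ (WCoord ν t z m)) ≤
      ENNReal.ofReal (‖psi t‖ * C * absN (m : E) ^
        (1 - ((2 * Module.finrank ℝ (Vec E) + 1 + j : ℕ) : ℝ) / (2 * Module.finrank ℝ E))) := by
  obtain ⟨a, ha, Θ, hv, hΘ⟩ := exists_kernel ν hΨ z
  have hmem : ∀ t m, conv Ψ (WCoord ν t z m) ∈ Smooth E := fun t m => by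
    rw [conv_WCoord ν t z m hΘ]
    exact (Smooth E).smul_mem _ (pull_mem _ _)
  refine ⟨hmem, fun X Y j => ?_⟩
  obtain ⟨Θ', hv', hΘ'⟩ := exists_biAct_pullS X Y hv
  obtain ⟨C, hC0, hC⟩ := lintegral_pull_le μ ha hv' j
  refine ⟨C, hC0, fun t m => ?_⟩
  rw [l1Norm, iInf_pos (hmem t m)]
  set c : ℂ := psi t / 2 * (absN (m : E) : ℝ) with hc
  have e : (⟨conv Ψ (WCoord ν t z m), hmem t m⟩ : Smooth E) = c • pullS (rootAbs m) Θ :=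
    Subtype.ext (conv_WCoord ν t z m hΘ)
  have e2 : biAct X Y (c • pullS (rootAbs m) Θ) = c • pullS (rootAbs m) Θ' := by
    rw [← hΘ', biAct, biAct, map_smul, map_smul]
  rw [e, e2]
  change ∫⁻ g, ‖c * pull (rootAbs m) Θ' g‖ₑ ∂μ ≤ _
  simp_rw [enorm_mul]
  rw [lintegral_const_mul' _ _ enorm_ne_top]
  refine (mul_le_mul_right (hC _ (rootAbs m).2) _).trans ?_
  have hm := absN_pos m
  rw [← ofReal_norm, ← ENNReal.ofReal_mul (norm_nonneg _)]
  apply ENNReal.ofReal_le_ofReal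
  have hcn : ‖c‖ ≤ ‖psi t‖ * absN (m : E) := by
    rw [hc, norm_mul, norm_div, Complex.norm_real, Real.norm_of_nonneg hm.le]
    gcongr
    simp
  rw [rootAbs_pow, ← Real.rpow_neg hm.le, sub_eq_add_neg, Real.rpow_add hm, Real.rpow_one]
  calc _ ≤ ‖psi t‖ * absN (m : E) * (C * absN (m : E) ^ (-(((2 * Module.finrank ℝ (Vec E) + 1 + j :
        ℕ) : ℝ) / (2 * Module.finrank ℝ E)))) := by gcongr
    _ = _ := by ring

lemma isIwasawa_diagGL (m : Eˣ) : IsIwasawa (diagGL m 1) (0 : E) 1 m 1 := by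
  refine ⟨by rw [Units.val_one]; exact one_mem _, ?_⟩
  simp

lemma psi_zero : psi (0 : E) = 1 := by simp [psi]

end Conv

end ArchGL2

end

/-! ### The three assertions. -/

theorem mainTheorem6 {E : Type*} [RCLike E]
    (μ : MeasureTheory.Measure (GL (Fin 2) E)) [μ.IsHaarMeasure]
    (ν : MeasureTheory.Measure (ArchGL2.GL1 E)) [ν.IsHaarMeasure] :
    (∀ Ψ ∈ ArchGL2.TestFun E, ∀ g : GL (Fin 2) E,
      ArchGL2.conv Ψ (ArchGL2.W ν g) ∈ ArchGL2.CSpace μ) ∧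
    (∀ Ψ ∈ ArchGL2.TestFun E, ∀ A : ℝ, 0 < A → ∀ X Y : ArchGL2.UEnv E, ∃ C : ℝ,
      ∀ m : Eˣ, 1 < ArchGL2.absN (m : E) →
        ArchGL2.l1Norm μ X Y (ArchGL2.conv Ψ (ArchGL2.W ν (ArchGL2.diagGL m 1)))
          ≤ ENNReal.ofReal (C * ArchGL2.absN (m : E) ^ (-A))) ∧
    (∃ B : ℝ, 0 < B ∧ ∀ Ψ ∈ ArchGL2.TestFun E, ∀ X Y : ArchGL2.UEnv E, ∃ C : ℝ,
      ∀ m : Eˣ, ArchGL2.absN (m : E) ≤ 1 →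
        ArchGL2.l1Norm μ X Y (ArchGL2.conv Ψ (ArchGL2.W ν (ArchGL2.diagGL m 1)))
          ≤ ENNReal.ofReal (C * ArchGL2.absN (m : E) ^ (-B))) := by
  have hd : (1 : ℝ) ≤ Module.finrank ℝ E := by
    exact_mod_cast Module.finrank_pos (R := ℝ) (M := E)
  refine ⟨fun Ψ hΨ g => ?_, fun Ψ hΨ A hA X Y => ?_,
    -- `B` is the exponent `k` at `j = 0`: for `|m| ≤ 1` it suffices that `-k ≤ 1 - k/(2d)`.
    ((2 * Module.finrank ℝ (ArchGL2.Vec E) + 1 + 0 : ℕ) : ℝ), by positivity, fun Ψ hΨ X Y => ?_⟩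
  -- `W ν g` unfolds to `WCoord` at some chosen coordinates, and the bound holds at all of them, so
  -- `W_eq` is not needed here.
  · refine ⟨(ArchGL2.conv_WCoord_bound μ ν hΨ _).1 _ _, fun X Y => ?_⟩
    obtain ⟨C, -, hC⟩ := (ArchGL2.conv_WCoord_bound μ ν hΨ _).2 X Y 0
    exact (hC _ _).trans_lt ENNReal.ofReal_lt_top
  -- This makes `k/(2d) ≥ A + 1`, where the extra 1 absorbs the factor `|m|`.
  · obtain ⟨j, hj⟩ := exists_nat_ge ((2 * Module.finrank ℝ E) * (A + 1))
    obtain ⟨C, hC0, hC⟩ := (ArchGL2.conv_WCoord_bound μ ν hΨ 1).2 X Y j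
    refine ⟨C, fun m hm => ?_⟩
    rw [ArchGL2.W_eq ν (ArchGL2.isIwasawa_diagGL m)]
    refine (hC 0 m).trans (ENNReal.ofReal_le_ofReal ?_)
    rw [ArchGL2.psi_zero, norm_one, one_mul]
    gcongr
    · exact hm.le
    · have h1 : A + 1 ≤ ((2 * Module.finrank ℝ (ArchGL2.Vec E) + 1 + j : ℕ) : ℝ) /
          (2 * Module.finrank ℝ E) := by
        rw [le_div_iff₀ (by positivity), mul_comm]
        refine hj.trans ?_
        exact_mod_cast Nat.le_add_left _ _
      linarith
  · obtain ⟨C, hC0, hC⟩ := (ArchGL2.conv_WCoord_bound μ ν hΨ 1).2 X Y 0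
    refine ⟨C, fun m hm => ?_⟩
    rw [ArchGL2.W_eq ν (ArchGL2.isIwasawa_diagGL m)]
    refine (hC 0 m).trans (ENNReal.ofReal_le_ofReal ?_)
    rw [ArchGL2.psi_zero, norm_one, one_mul]
    refine mul_le_mul_of_nonneg_left ?_ hC0
    refine Real.rpow_le_rpow_of_exponent_ge (ArchGL2.absN_pos m) hm ?_
    have h1 : ((2 * Module.finrank ℝ (ArchGL2.Vec E) + 1 + 0 : ℕ) : ℝ) /
        (2 * Module.finrank ℝ E) ≤ ((2 * Module.finrank ℝ (ArchGL2.Vec E) + 1 + 0 : ℕ) : ℝ) :=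
      div_le_self (by positivity) (by linarith)
    linarith
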